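/- **Globular sets and trees.** A globular set $X$ consists of sets $X_n$ ($n\in\mathbb N$) and maps $\mathrm{src},\mathrm{tgt}:X_{n+1}\to X_n$ with $\mathrm{src}\,\mathrm{src}=\mathrm{src}\,\mathrm{tgt}$ and $\mathrm{tgt}\,\mathrm{src}=\mathrm{tgt}\,\mathrm{tgt}$; $\mathrm{Glob}$ is the category of globular sets. Two $n$-cells are parallel if $n=0$ or they have the same source and the same target. Batanin trees are generated inductively by $\mathrm{br}\,[B_1,\dots,B_k]$, $k\ge 0$; $\dim B$ is the height of $B$. The globular set $\mathrm{Pos}(B)$ of positions of $B$ is given inductively by: a $0$-position $\mathrm{here}$ of every tree; for each $n$-position $p$ of $\mathrm{br}\,L$ an $n$-position $\mathrm{inr}\,p$ of $\mathrm{br}\,(B::L)$; for each $n$-position $q$ of $B$ an $(n+1)$-position $\mathrm{inl}\,q$ of $\mathrm{br}\,(B::L)$. Source and target are $\mathrm{src}(\mathrm{inr}\,p)=\mathrm{inr}(\mathrm{src}\,p)$, $\mathrm{src}(\mathrm{inl}\,q)=\mathrm{here}$ if $\dim q=0$ and $\mathrm{inl}(\mathrm{src}\,q)$ otherwise; $\mathrm{tgt}(\mathrm{inr}\,p)=\mathrm{inr}(\mathrm{tgt}\,p)$,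 $\mathrm{tgt}(\mathrm{inl}\,q)=\mathrm{inr}(\mathrm{here})$ if $\dim q=0$ and $\mathrm{inl}(\mathrm{tgt}\,q)$ otherwise. Let $\partial^s_n B$ (resp. $\partial^t_n B$) be the set of $n$-positions that are not the target (resp. source) of an $(n+1)$-position. **Computads.** Define by recursion on $n$ the category $\mathrm{Comp}_n$ of $n$-computads and $n$-homomorphisms, functors $\mathrm{Cell}_n,\mathrm{Sph}_n:\mathrm{Comp}_n\to\mathrm{Set}$ and $\mathrm{Free}_n:\mathrm{Glob}\to\mathrm{Comp}_n$, an $n$-sphere $\langle a,b\rangle$ of $\mathrm{Free}_nX$ for parallel $a,b\in X_n$, and the full $n$-spheres of each Batanin tree $B$, which are certain $n$-spheres of $\mathrm{Free}_nB:=\mathrm{Free}_n\mathrm{Pos}(B)$. * $n=0$: $\mathrm{Comp}_0=\mathrm{Set}$, $\mathrm{Cell}_0C=C$, $\mathrm{Sph}_0C=C\times C$, $\mathrm{Free}_0X=X_0$, $\langle a,b\rangle=(a,b)$, and $(a,b)$ is full iff $a\in\partial^s_0B$ and $b\in\partial^t_0B$. * $n\ge1$: an $n$-computad is a triple $C=(C_{n-1},V^C_n,\phi^C_n)$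 with $C_{n-1}$ an $(n-1)$-computad, $V^C_n$ a set of generators, $\phi^C_n:V^C_n\to\mathrm{Sph}_{n-1}(C_{n-1})$. Inductively and simultaneously: $\mathrm{Cell}_n(C)$ consists of $\mathrm{var}\,v$ for $v\in V^C_n$ and of $\mathrm{coh}(B,A,\tau)$ for $B$ a Batanin tree with $\dim B\le n$, $A$ a full $(n-1)$-sphere of $B$ and $\tau:\mathrm{Free}_nB\to C$ an $n$-homomorphism; the boundary is $\mathrm{ty}(\mathrm{var}\,v)=\phi^C_n(v)$, $\mathrm{ty}(\mathrm{coh}(B,A,\tau))=\mathrm{Sph}_{n-1}(\tau_{n-1})(A)$; an $n$-homomorphism $\sigma:D\to C$ is a pair of an $(n-1)$-homomorphism $\sigma_{n-1}:D_{n-1}\to C_{n-1}$ and a map $\sigma_V:V^D_n\to\mathrm{Cell}_n(C)$ with $\mathrm{ty}(\sigma_V(v))=\mathrm{Sph}_{n-1}(\sigma_{n-1})(\phi^D_n(v))$. Homomorphisms act on cells by $\mathrm{var}\,v\mapsto\sigma_V(v)$, $\mathrm{coh}(B,A,\tau)\mapsto\mathrm{coh}(B,A,\sigma\tau)$, with $\sigma\tau=(\sigma_{n-1}\tau_{n-1},\mathrm{Cell}_n(\sigma)\circ\tau_V)$.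 An $n$-sphere is a triple $(A,a,b)$ with $a,b\in\mathrm{Cell}_n(C)$ and $\mathrm{ty}(a)=\mathrm{ty}(b)=A$. Further, $\mathrm{Free}_nX=(\mathrm{Free}_{n-1}X,X_n,x\mapsto\langle\mathrm{src}\,x,\mathrm{tgt}\,x\rangle)$, $\mathrm{Free}_nf=(\mathrm{Free}_{n-1}f,x\mapsto\mathrm{var}(f_nx))$, and $\langle a,b\rangle=(\langle\mathrm{src}\,a,\mathrm{tgt}\,a\rangle,\mathrm{var}\,a,\mathrm{var}\,b)$. The support of a cell is given by $\mathrm{supp}(\mathrm{var}\,v)=\{v\}$ and $\mathrm{supp}(\mathrm{coh}(B,A,\tau))=\bigcup_{p\in\mathrm{Pos}_n(B)}\mathrm{supp}(\tau_V(p))$; an $n$-sphere $(A,a,b)$ of $\mathrm{Free}_nB$ is full iff $\mathrm{supp}(a)=\partial^s_nB$, $\mathrm{supp}(b)=\partial^t_nB$ and $A$ is full. The category $\mathrm{Comp}$ of computads is the limit of the $\mathrm{Comp}_n$ along the forgetful functors $C\mapsto C_{n-1}$; the $\mathrm{Free}_n$ give a functor $\mathrm{Free}:\mathrm{Glob}\to\mathrm{Comp}$,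 and $\mathrm{Free}\,B$ means $\mathrm{Free}\,\mathrm{Pos}(B)$. The cells of a computad form a globular set, the source and target of a cell being the two cells of its boundary sphere; this gives a right adjoint $\mathrm{Cell}$ of $\mathrm{Free}$ and a monad $\mathrm{fc}^w=\mathrm{Cell}\circ\mathrm{Free}$ on $\mathrm{Glob}$. **Generator-preserving and generic morphisms.** A homomorphism of computads is generator-preserving if it sends every generator to a generator. A homomorphism $\sigma:\mathrm{Free}\,X\to\mathrm{Free}\,Y$ is generic if for all globular sets $Z,W$, all $\tau:\mathrm{Free}\,X\to\mathrm{Free}\,Z$ and all generator-preserving $f:\mathrm{Free}\,Y\to\mathrm{Free}\,W$, $g:\mathrm{Free}\,Z\to\mathrm{Free}\,W$ with $f\sigma=g\tau$ there is a unique homomorphism $h:\mathrm{Free}\,Y\to\mathrm{Free}\,Z$ with $h\sigma=\tau$ and $gh=f$. **Arities.** Let $i:\mathcal A\hookrightarrow\mathcal E$ be a small full subcategory, with nerve $\nu:\mathcal E\to[\mathcal A^{op},\mathrm{Set}]$, $\nu(X)=\mathcal E(i-,X)$. A monad $T$ on $\mathcal E$ has arities in $\mathcal A$ if, for every object $X$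 of $\mathcal E$, the canonical cocone with vertex $X$ on $\mathcal A/X\to\mathcal A\to\mathcal E$ is a colimit cocone ($\mathcal A$ is dense), and $\nu T$ sends it to a colimit cocone. Let $\Theta_0$ be the category with objects the Batanin trees and $\Theta_0(B,B')=\mathrm{Glob}(\mathrm{Pos}(B),\mathrm{Pos}(B'))$, regarded as a full subcategory of $\mathrm{Glob}$ via $\mathrm{Pos}$. **Proposition.** (1) Let $B$ be a Batanin tree, $X$ a globular set and $\sigma:\mathrm{Free}\,B\to\mathrm{Free}\,X$ a homomorphism of computads. Then there are a Batanin tree $B_\sigma$, a generic homomorphism $\mathrm{gen}_\sigma:\mathrm{Free}\,B\to\mathrm{Free}\,B_\sigma$ and a generator-preserving homomorphism $\mathrm{fr}_\sigma:\mathrm{Free}\,B_\sigma\to\mathrm{Free}\,X$ with $\sigma=\mathrm{fr}_\sigma\,\mathrm{gen}_\sigma$. The triple $(B_\sigma,\mathrm{gen}_\sigma,\mathrm{fr}_\sigma)$ is unique with these properties, and $\dim B_\sigma\le\dim B$. (2) The monad $\mathrm{fc}^w$ has arities in $\Theta_0$. -/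

import Mathlib

open CategoryTheory CategoryTheory.Limits

attribute [-instance] CategoryTheory.catToReflQuiver

universe v₁ v₂ u₁ u₂ u

namespace Computads

/-! ### Globular sets -/

/-- A globular set. -/
structure Glob : Type (u + 1) where
  cell : ℕ → Type u
  src : ∀ {n : ℕ}, cell (n + 1) → cell n
  tgt : ∀ {n : ℕ}, cell (n + 1) → cell n
  src_src : ∀ {n : ℕ} (x : cell (n + 2)), src (src x) = src (tgt x)
  tgt_src : ∀ {n : ℕ} (x : cell (n + 2)), tgt (src x) = tgt (tgt x)

namespace Glob

/-- Morphisms of globular sets. -/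
@[ext]
structure Hom (X Y : Glob.{u}) : Type u where
  app : ∀ n : ℕ, X.cell n → Y.cell n
  app_src : ∀ {n : ℕ} (x : X.cell (n + 1)), app n (X.src x) = Y.src (app (n + 1) x)
  app_tgt : ∀ {n : ℕ} (x : X.cell (n + 1)), app n (X.tgt x) = Y.tgt (app (n + 1) x)

instance : Category.{u} Glob.{u} where
  Hom X Y := Hom X Y
  id X := ⟨fun _ x => x, fun _ => rfl, fun _ => rfl⟩
  comp f g := ⟨fun n x => g.app n (f.app n x),
    fun x => by rw [f.app_src, g.app_src], fun x => by rw [f.app_tgt, g.app_tgt]⟩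

theorem id_app (X : Glob.{u}) (n : ℕ) (x : X.cell n) : Hom.app (𝟙 X) n x = x := rfl

theorem comp_app {X Y Z : Glob.{u}} (f : X ⟶ Y) (g : Y ⟶ Z) (n : ℕ) (x : X.cell n) :
    Hom.app (f ≫ g) n x = Hom.app g n (Hom.app f n x) := rfl

theorem hom_ext {X Y : Glob.{u}} {f g : X ⟶ Y}
    (h : ∀ (n : ℕ) (x : X.cell n), Hom.app f n x = Hom.app g n x) : f = g :=
  Hom.ext (funext fun n => funext fun x => h n x)

/-- Two `n`-cells are parallel if they have common source and target
(which is no condition when `n = 0`). -/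
def Parallel (X : Glob.{u}) : ∀ {n : ℕ}, X.cell n → X.cell n → Prop
  | 0, _, _ => True
  | _ + 1, a, b => X.src a = X.src b ∧ X.tgt a = X.tgt b

theorem parallel_src_tgt (X : Glob.{u}) : ∀ {n : ℕ} (x : X.cell (n + 1)),
    X.Parallel (X.src x) (X.tgt x)
  | 0, _ => trivial
  | _ + 1, x => ⟨X.src_src x, X.tgt_src x⟩

theorem Parallel.map {X Y : Glob.{u}} (f : X ⟶ Y) : ∀ {n : ℕ} {a b : X.cell n},
    X.Parallel a b → Y.Parallel (Hom.app f n a) (Hom.app f n b)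
  | 0, _, _, _ => trivial
  | _ + 1, a, b, h => ⟨by rw [← f.app_src, ← f.app_src, h.1], by rw [← f.app_tgt, ← f.app_tgt, h.2]⟩

end Glob

/-! ### Batanin trees and their positions -/

/-- Batanin trees. -/
inductive Bat : Type
  | br : List Bat → Bat

mutual
/-- The dimension (height) of a Batanin tree: `dim (br []) = 0` and
`dim (br (B :: L)) = max (dim B + 1) (dim (br L))`. -/
def Bat.dim : Bat → ℕ
  | .br L => Bat.dimList L
/-- Auxiliary: the dimension of `br L`. -/
def Bat.dimList : List Bat → ℕ
  | [] => 0
  | B :: L => max (B.dim + 1) (Bat.dimList L)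
end

/-- The positions of a Batanin tree, by dimension. -/
inductive Pos : Bat → ℕ → Type u
  | here (B : Bat) : Pos B 0
  | inr (B : Bat) (L : List Bat) {n : ℕ} (p : Pos (.br L) n) : Pos (.br (B :: L)) n
  | inl (B : Bat) (L : List Bat) {n : ℕ} (q : Pos B n) : Pos (.br (B :: L)) (n + 1)

namespace Pos

/-- The source of a position of dimension `m = n + 1`. -/
def srcAux : ∀ {B : Bat} {m : ℕ}, Pos.{u} B m → ∀ n : ℕ, m = n + 1 → Pos.{u} B n
  | _, _, .here _, _, h => absurd h (Nat.succ_ne_zero _).symm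
  | _, _, .inr B L p, n, h => .inr B L (srcAux p n h)
  | _, _, .inl B L _, 0, _ => .here (.br (B :: L))
  | _, _, .inl B L q, n + 1, h => .inl B L (srcAux q n (Nat.succ.inj h))

/-- The target of a position of dimension `m = n + 1`. -/
def tgtAux : ∀ {B : Bat} {m : ℕ}, Pos.{u} B m → ∀ n : ℕ, m = n + 1 → Pos.{u} B n
  | _, _, .here _, _, h => absurd h (Nat.succ_ne_zero _).symm
  | _, _, .inr B L p, n, h => .inr B L (tgtAux p n h)
  | _, _, .inl B L _, 0, _ => .inr B L (.here (.br L))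
  | _, _, .inl B L q, n + 1, h => .inl B L (tgtAux q n (Nat.succ.inj h))

/-- The source of a position; see the three equations below. -/
def src {B : Bat} {n : ℕ} (p : Pos.{u} B (n + 1)) : Pos.{u} B n := srcAux p n rfl

/-- The target of a position; see the three equations below. -/
def tgt {B : Bat} {n : ℕ} (p : Pos.{u} B (n + 1)) : Pos.{u} B n := tgtAux p n rfl

theorem src_inr (B : Bat) (L : List Bat) {n : ℕ} (p : Pos.{u} (.br L) (n + 1)) :
    src (.inr B L p) = .inr B L (src p) := rfl

theorem src_inl_zero (B : Bat) (L : List Bat) (q : Pos.{u} B 0) :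
    src (.inl B L q) = .here (.br (B :: L)) := rfl

theorem src_inl_succ (B : Bat) (L : List Bat) {n : ℕ} (q : Pos.{u} B (n + 1)) :
    src (.inl B L q) = .inl B L (src q) := rfl

theorem tgt_inr (B : Bat) (L : List Bat) {n : ℕ} (p : Pos.{u} (.br L) (n + 1)) :
    tgt (.inr B L p) = .inr B L (tgt p) := rfl

theorem tgt_inl_zero (B : Bat) (L : List Bat) (q : Pos.{u} B 0) :
    tgt (.inl B L q) = .inr B L (.here (.br L)) := rfl

theorem tgt_inl_succ (B : Bat) (L : List Bat) {n : ℕ} (q : Pos.{u} B (n + 1)) :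
    tgt (.inl B L q) = .inl B L (tgt q) := rfl

theorem src_src : ∀ {B : Bat} {n : ℕ} (p : Pos.{u} B (n + 2)), src (src p) = src (tgt p)
  | _, _, .inr B L p => congrArg (Pos.inr B L) (src_src p)
  | _, 0, .inl _ _ _ => rfl
  | _, _ + 1, .inl B L q => congrArg (Pos.inl B L) (src_src q)

theorem tgt_src : ∀ {B : Bat} {n : ℕ} (p : Pos.{u} B (n + 2)), tgt (src p) = tgt (tgt p)
  | _, _, .inr B L p => congrArg (Pos.inr B L) (tgt_src p)
  | _, 0, .inl _ _ _ => rfl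
  | _, _ + 1, .inl B L q => congrArg (Pos.inl B L) (tgt_src q)

end Pos

/-- The globular set of positions of a Batanin tree. -/
@[reducible]
def pos (B : Bat) : Glob.{u} where
  cell n := Pos.{u} B n
  src := Pos.src
  tgt := Pos.tgt
  src_src := Pos.src_src
  tgt_src := Pos.tgt_src

/-- The source boundary positions of dimension `n`: those that are not a target. -/
def srcBoundary (B : Bat) (n : ℕ) : Set (Pos.{u} B n) :=
  {p | ¬ ∃ q : Pos.{u} B (n + 1), q.tgt = p}

/-- The target boundary positions of dimension `n`: those that are not a source. -/
def tgtBoundary (B : Bat) (n : ℕ) : Set (Pos.{u} B n) :=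
  {p | ¬ ∃ q : Pos.{u} B (n + 1), q.src = p}

/-! ### Finite-dimensional computads

The structures on `n`-computads are defined together by recursion on `n`.  `Stage n` is the type of
the data produced at step `n`; `Stage.zero` is the base case, `Stage.succ` the inductive step, and
`stage n` the resulting data for `n`-computads.  Nothing below refers to an arbitrary `Stage`
except the construction `Stage.succ` and its basic properties. -/

/-- The data defined at step `n` of the recursion, with the properties needed by the next step. -/
structure Stage (n : ℕ) : Type (u + 2) where
  /-- `n`-computads -/
  Obj : Type (u + 1)
  /-- `n`-homomorphisms -/
  [cat : Category.{u} Obj]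
  /-- the `n`-cells of an `n`-computad -/
  cell : Obj → Type u
  cellMap : ∀ {C D : Obj}, (C ⟶ D) → cell C → cell D
  cellMap_id : ∀ {C : Obj} (c : cell C), cellMap (𝟙 C) c = c
  cellMap_comp : ∀ {C D E : Obj} (f : C ⟶ D) (g : D ⟶ E) (c : cell C),
    cellMap (f ≫ g) c = cellMap g (cellMap f c)
  /-- the `n`-spheres of an `n`-computad -/
  sph : Obj → Type u
  sphMap : ∀ {C D : Obj}, (C ⟶ D) → sph C → sph D
  sphMap_id : ∀ {C : Obj} (A : sph C), sphMap (𝟙 C) A = A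
  sphMap_comp : ∀ {C D E : Obj} (f : C ⟶ D) (g : D ⟶ E) (A : sph C),
    sphMap (f ≫ g) A = sphMap g (sphMap f A)
  /-- the two `n`-cells of an `n`-sphere -/
  fst : ∀ {C : Obj}, sph C → cell C
  snd : ∀ {C : Obj}, sph C → cell C
  fst_map : ∀ {C D : Obj} (f : C ⟶ D) (A : sph C), fst (sphMap f A) = cellMap f (fst A)
  snd_map : ∀ {C D : Obj} (f : C ⟶ D) (A : sph C), snd (sphMap f A) = cellMap f (snd A)
  sph_ext : ∀ {C : Obj} (A A' : sph C), fst A = fst A' → snd A = snd A' → A = A'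
  /-- the `n`-computad of a globular set -/
  free : Glob.{u} ⥤ Obj
  /-- the `n`-cells of a globular set, as cells of its `n`-computad -/
  gen : ∀ (X : Glob.{u}), X.cell n → cell (free.obj X)
  gen_map : ∀ {X Y : Glob.{u}} (f : X ⟶ Y) (x : X.cell n),
    cellMap (free.map f) (gen X x) = gen Y (Glob.Hom.app f n x)
  /-- the `n`-sphere of a parallel pair of cells of a globular set -/
  posSph : ∀ (X : Glob.{u}) (a b : X.cell n), X.Parallel a b → sph (free.obj X)
  fst_posSph : ∀ (X : Glob.{u}) (a b : X.cell n) (h : X.Parallel a b),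
    fst (posSph X a b h) = gen X a
  snd_posSph : ∀ (X : Glob.{u}) (a b : X.cell n) (h : X.Parallel a b),
    snd (posSph X a b h) = gen X b
  /-- the full `n`-spheres of a Batanin tree -/
  full : ∀ B : Bat, Set (sph (free.obj (pos B)))
  /-- the generator-preserving `n`-homomorphisms -/
  genPres : ∀ {C D : Obj}, (C ⟶ D) → Prop

attribute [instance] Stage.cat

namespace Stage

theorem posSph_map {n : ℕ} (S : Stage.{u} n) {X Y : Glob.{u}} (f : X ⟶ Y) (a b : X.cell n)
    (h : X.Parallel a b) :
    S.sphMap (S.free.map f) (S.posSph X a b h) =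
      S.posSph Y (Glob.Hom.app f n a) (Glob.Hom.app f n b) (h.map f) := by
  apply S.sph_ext
  · rw [S.fst_map, S.fst_posSph, S.fst_posSph, S.gen_map]
  · rw [S.snd_map, S.snd_posSph, S.snd_posSph, S.gen_map]

theorem posSph_congr {n : ℕ} (S : Stage.{u} n) (X : Glob.{u}) {a a' b b' : X.cell n} (ha : a = a')
    (hb : b = b') (h : X.Parallel a b) (h' : X.Parallel a' b') :
    S.posSph X a b h = S.posSph X a' b' h' := by
  subst ha hb
  rfl

/-- The base case: `0`-computads are sets, their cells are their elements, and a `0`-sphere is a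
pair of elements. -/
def zero : Stage.{u} 0 where
  Obj := Type u
  cell C := C
  cellMap f c := f c
  cellMap_id _ := rfl
  cellMap_comp _ _ _ := rfl
  sph C := C × C
  sphMap f A := (f A.1, f A.2)
  sphMap_id _ := rfl
  sphMap_comp _ _ _ := rfl
  fst A := A.1
  snd A := A.2
  fst_map _ _ := rfl
  snd_map _ _ := rfl
  sph_ext _ _ h h' := Prod.ext h h'
  free :=
    { obj := fun X => X.cell 0
      map := fun f => ↾(Glob.Hom.app f 0) }
  gen _ x := x
  gen_map _ _ := rfl
  posSph _ a b _ := (a, b)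
  fst_posSph _ _ _ _ := rfl
  snd_posSph _ _ _ _ := rfl
  full B := {A : Pos.{u} B 0 × Pos.{u} B 0 | A.1 ∈ srcBoundary B 0 ∧ A.2 ∈ tgtBoundary B 0}
  genPres _ := True

section Succ

variable {n : ℕ} (S : Stage.{u} n)

/-- An `(n+1)`-computad: an `n`-computad with a set of generators and their boundary spheres. -/
structure SObj : Type (u + 1) where
  base : S.Obj
  V : Type u
  bd : V → S.sph base

/-- The `(n+1)`-computad of a globular set. -/
@[reducible]
def freeObj (X : Glob.{u}) : S.SObj where
  base := S.free.obj X
  V := X.cell (n + 1)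
  bd x := S.posSph X (X.src x) (X.tgt x) (X.parallel_src_tgt x)

/-- Expressions for `(n+1)`-cells over an `n`-computad `C` and a set `V` of generators: generators,
and coherences given by a Batanin tree `B` of dimension at most `n + 1`, a full `n`-sphere `A` of
`B` and the two components of a homomorphism `τ` out of the computad of `B`, for which the
compatibility of `τ` with boundaries is not required yet. -/
inductive PreCell (C : S.Obj) (V : Type u) : Type u
  | var (v : V) : PreCell C V
  | coh (B : Bat) (hB : B.dim ≤ n + 1) (A : S.sph (S.free.obj (pos B))) (hA : A ∈ S.full B)
      (τ : S.free.obj (pos B) ⟶ C) (τV : Pos.{u} B (n + 1) → PreCell C V) : PreCell C V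

namespace PreCell

variable {S}

/-- The boundary sphere of a cell, given those of the generators. -/
def ty {C : S.Obj} {V : Type u} (φ : V → S.sph C) : S.PreCell C V → S.sph C
  | var v => φ v
  | coh _ _ A _ τ _ => S.sphMap τ A

/-- The expression is a cell: in every coherence occurring in it, the pair `(τ, τV)` is a
homomorphism of `(n+1)`-computads. -/
def WF {C : S.Obj} {V : Type u} (φ : V → S.sph C) : S.PreCell C V → Prop
  | var _ => True
  | coh B _ _ _ τ τV => ∀ p : Pos.{u} B (n + 1),
      (τV p).WF φ ∧ (τV p).ty φ = S.sphMap τ ((S.freeObj (pos B)).bd p)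

/-- The action of a homomorphism on expressions. -/
def map {C D : S.Obj} {V W : Type u} (f : C ⟶ D) (g : V → S.PreCell D W) :
    S.PreCell C V → S.PreCell D W
  | var v => g v
  | coh B hB A hA τ τV => coh B hB A hA (τ ≫ f) fun p => (τV p).map f g

/-- The support of a cell: the set of generators of top dimension occurring in it. -/
def supp {C : S.Obj} {V : Type u} : S.PreCell C V → Set V
  | var v => {v}
  | coh _ _ _ _ _ τV => ⋃ p, (τV p).supp

theorem ty_map {C D : S.Obj} {V W : Type u} {φ : V → S.sph C} {ψ : W → S.sph D} {f : C ⟶ D}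
    {g : V → S.PreCell D W} (h : ∀ v, (g v).ty ψ = S.sphMap f (φ v)) (c : S.PreCell C V) :
    (c.map f g).ty ψ = S.sphMap f (c.ty φ) := by
  cases c with
  | var v => exact h v
  | coh B hB A hA τ τV => exact S.sphMap_comp _ _ _

theorem WF.map {C D : S.Obj} {V W : Type u} {φ : V → S.sph C} {ψ : W → S.sph D} {f : C ⟶ D}
    {g : V → S.PreCell D W} (h : ∀ v, (g v).ty ψ = S.sphMap f (φ v)) (hg : ∀ v, (g v).WF ψ)
    (c : S.PreCell C V) (hc : c.WF φ) : (c.map f g).WF ψ := by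
  induction c with
  | var v => exact hg v
  | coh B hB A hA τ τV ih =>
    intro p
    exact ⟨ih p (hc p).1, by rw [ty_map h, (hc p).2, S.sphMap_comp]⟩

theorem map_id {C : S.Obj} {V : Type u} (c : S.PreCell C V) : c.map (𝟙 C) var = c := by
  induction c with
  | var v => rfl
  | coh B hB A hA τ τV ih => simp only [PreCell.map, ih, Category.comp_id]

theorem map_map {C D E : S.Obj} {V W U : Type u} (f : C ⟶ D) (g : V → S.PreCell D W) (f' : D ⟶ E)
    (g' : W → S.PreCell E U) (c : S.PreCell C V) :
    (c.map f g).map f' g' = c.map (f ≫ f') fun v => (g v).map f' g' := by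
  induction c with
  | var v => rfl
  | coh B hB A hA τ τV ih => simp only [PreCell.map, ih, Category.assoc]

end PreCell

/-- The `(n+1)`-cells of an `(n+1)`-computad. -/
def SCell (C : S.SObj) : Type u := {c : S.PreCell C.base C.V // c.WF C.bd}

variable {S}

/-- An `(n+1)`-homomorphism: an `n`-homomorphism together with a map from generators to cells that
is compatible with boundaries. -/
@[ext]
structure SHom (C D : S.SObj) : Type u where
  base : C.base ⟶ D.base
  onGen : C.V → S.SCell D
  comm : ∀ v : C.V, (onGen v).1.ty D.bd = S.sphMap base (C.bd v)

/-- A generator, as a cell. -/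
def SCell.var {C : S.SObj} (v : C.V) : S.SCell C := ⟨.var v, trivial⟩

/-- The coherence cell given by a Batanin tree `B` of dimension at most `n + 1`, a full `n`-sphere
`A` of `B` and an `(n+1)`-homomorphism `τ` out of the computad of `B`. -/
def SCell.coh {C : S.SObj} (B : Bat) (hB : B.dim ≤ n + 1) (A : S.sph (S.free.obj (pos B)))
    (hA : A ∈ S.full B) (τ : SHom (S.freeObj (pos B)) C) : S.SCell C :=
  ⟨.coh B hB A hA τ.base fun p => (τ.onGen p).1, fun p => ⟨(τ.onGen p).2, τ.comm p⟩⟩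

/-- Every cell is a generator or a coherence cell. -/
theorem SCell.eq_var_or_coh {C : S.SObj} : ∀ c : S.SCell C, (∃ v, c = SCell.var v) ∨
    ∃ (B : Bat) (hB : B.dim ≤ n + 1) (A : S.sph (S.free.obj (pos B))) (hA : A ∈ S.full B)
      (τ : SHom (S.freeObj (pos B)) C), c = SCell.coh B hB A hA τ
  | ⟨.var v, _⟩ => .inl ⟨v, rfl⟩
  | ⟨.coh B hB A hA τ τV, h⟩ =>
    .inr ⟨B, hB, A, hA, ⟨τ, fun p => ⟨τV p, (h p).1⟩, fun p => (h p).2⟩, rfl⟩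

/-- The action of a homomorphism on cells. -/
def SHom.cellMap {C D : S.SObj} (f : SHom C D) (c : S.SCell C) : S.SCell D :=
  ⟨c.1.map f.base fun v => (f.onGen v).1, c.2.map f.comm (fun v => (f.onGen v).2)⟩

variable (S)

instance : Category.{u} S.SObj where
  Hom C D := SHom C D
  id C := ⟨𝟙 C.base, fun v => ⟨.var v, trivial⟩, fun v => (S.sphMap_id _).symm⟩
  comp f g := ⟨f.base ≫ g.base, fun v => g.cellMap (f.onGen v), fun v => by
    rw [S.sphMap_comp, ← f.comm v]
    exact PreCell.ty_map g.comm _⟩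
  id_comp f := SHom.ext (Category.id_comp _) (funext fun _ => rfl)
  comp_id f := SHom.ext (Category.comp_id _)
    (funext fun v => Subtype.ext (PreCell.map_id (f.onGen v).1))
  assoc f g h := SHom.ext (Category.assoc _ _ _)
    (funext fun v => Subtype.ext (PreCell.map_map _ _ _ _ (f.onGen v).1))

/-- An `(n+1)`-sphere: a pair of `(n+1)`-cells with the same given boundary `n`-sphere. -/
@[ext]
structure SSph (C : S.SObj) : Type u where
  bd : S.sph C.base
  fst : S.SCell C
  snd : S.SCell C
  ty_fst : fst.1.ty C.bd = bd
  ty_snd : snd.1.ty C.bd = bd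

/-- The inductive step. -/
def succ : Stage.{u} (n + 1) where
  Obj := S.SObj
  cell := S.SCell
  cellMap f c := SHom.cellMap f c
  cellMap_id c := Subtype.ext (PreCell.map_id c.1)
  cellMap_comp f g c := Subtype.ext (PreCell.map_map _ _ _ _ c.1).symm
  sph := S.SSph
  sphMap f A := ⟨S.sphMap f.base A.bd, f.cellMap A.fst, f.cellMap A.snd,
    (PreCell.ty_map f.comm _).trans (by rw [A.ty_fst]),
    (PreCell.ty_map f.comm _).trans (by rw [A.ty_snd])⟩
  sphMap_id A := SSph.ext (S.sphMap_id _) (Subtype.ext (PreCell.map_id A.fst.1))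
    (Subtype.ext (PreCell.map_id A.snd.1))
  sphMap_comp f g A := SSph.ext (S.sphMap_comp _ _ _)
    (Subtype.ext (PreCell.map_map _ _ _ _ A.fst.1).symm)
    (Subtype.ext (PreCell.map_map _ _ _ _ A.snd.1).symm)
  fst A := A.fst
  snd A := A.snd
  fst_map _ _ := rfl
  snd_map _ _ := rfl
  sph_ext A A' h h' := SSph.ext (by rw [← A.ty_fst, ← A'.ty_fst, h]) h h'
  free :=
    { obj := S.freeObj
      map := fun f => ⟨S.free.map f, fun x => ⟨.var (Glob.Hom.app f (n + 1) x), trivial⟩, fun x => by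
        refine Eq.trans ?_ (S.posSph_map f _ _ _).symm
        exact S.posSph_congr _ (Glob.Hom.app_src f x).symm (Glob.Hom.app_tgt f x).symm _ _⟩
      map_id := fun X => SHom.ext (S.free.map_id X) rfl
      map_comp := fun f g => SHom.ext (S.free.map_comp f g) rfl }
  gen _ x := ⟨.var x, trivial⟩
  gen_map _ _ := rfl
  posSph X a b h := ⟨S.posSph X (X.src a) (X.tgt a) (X.parallel_src_tgt a),
    ⟨.var a, trivial⟩, ⟨.var b, trivial⟩, rfl, by
      exact (S.posSph_congr _ h.1 h.2 _ _).symm⟩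
  fst_posSph _ _ _ _ := rfl
  snd_posSph _ _ _ _ := rfl
  full B := {A | A.fst.1.supp = srcBoundary B (n + 1) ∧ A.snd.1.supp = tgtBoundary B (n + 1) ∧
    A.bd ∈ S.full B}
  genPres f := S.genPres f.base ∧ ∀ v, ∃ w, (f.onGen v).1 = .var w

/-- The forgetful functor from `(n+1)`-computads to `n`-computads. -/
def forget : S.succ.Obj ⥤ S.Obj where
  obj C := SObj.base C
  map f := SHom.base f
  map_id _ := rfl
  map_comp _ _ := rfl

/-- The boundary `n`-sphere of an `(n+1)`-cell. -/
def ty {C : S.succ.Obj} (c : S.succ.cell C) : S.sph (S.forget.obj C) :=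
  PreCell.ty (SObj.bd C) (Subtype.val c)

end Succ

end Stage

/-- The category of `n`-computads with its cells, spheres, free computads, full spheres and
generator-preserving homomorphisms. -/
@[reducible]
def stage : ∀ n : ℕ, Stage.{u} n
  | 0 => Stage.zero
  | n + 1 => (stage n).succ

/-- The forgetful functor from `(n+1)`-computads to `n`-computads. -/
def trunc (n : ℕ) : (stage.{u} (n + 1)).Obj ⥤ (stage.{u} n).Obj := (stage.{u} n).forget

/-- The boundary `n`-sphere of an `(n+1)`-cell. -/
def cellTy {n : ℕ} {C : (stage.{u} (n + 1)).Obj} (c : (stage.{u} (n + 1)).cell C) :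
    (stage.{u} n).sph ((trunc n).obj C) :=
  (stage.{u} n).ty c

theorem cellTy_map {n : ℕ} {C D : (stage.{u} (n + 1)).Obj} (f : C ⟶ D)
    (c : (stage.{u} (n + 1)).cell C) :
    cellTy ((stage.{u} (n + 1)).cellMap f c) = (stage.{u} n).sphMap ((trunc n).map f) (cellTy c) :=
  Stage.PreCell.ty_map (Stage.SHom.comm f) c.1

theorem cellTy_fst {n : ℕ} {C : (stage.{u} (n + 1)).Obj} (A : (stage.{u} (n + 1)).sph C) :
    cellTy ((stage.{u} (n + 1)).fst A) = cellTy ((stage.{u} (n + 1)).snd A) :=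
  (Stage.SSph.ty_fst A).trans (Stage.SSph.ty_snd A).symm

/-! ### Computads -/

/-- A computad: an object of the limit of the categories of `n`-computads along the forgetful
functors. -/
structure Comp : Type (u + 1) where
  obj : ∀ n : ℕ, (stage.{u} n).Obj
  trunc_obj : ∀ n : ℕ, (trunc n).obj (obj (n + 1)) = obj n

namespace Comp

/-- A homomorphism of computads: a sequence of `n`-homomorphisms, each being the truncation of the
next one. -/
@[ext]
structure Hom (C D : Comp.{u}) : Type u where
  app : ∀ n : ℕ, C.obj n ⟶ D.obj n
  trunc_map : ∀ n : ℕ, (trunc n).map (app (n + 1)) ≫ eqToHom (D.trunc_obj n) =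
    eqToHom (C.trunc_obj n) ≫ app n

instance : Category.{u} Comp.{u} where
  Hom C D := Hom C D
  id C := ⟨fun n => 𝟙 (C.obj n), fun n => by simp⟩
  comp f g := ⟨fun n => f.app n ≫ g.app n, fun n => by
    rw [Functor.map_comp, Category.assoc, g.trunc_map, ← Category.assoc, f.trunc_map,
      Category.assoc]⟩
  id_comp f := Hom.ext (funext fun _ => Category.id_comp _)
  comp_id f := Hom.ext (funext fun _ => Category.comp_id _)
  assoc f g h := Hom.ext (funext fun _ => Category.assoc _ _ _)

theorem comp_app {C D E : Comp.{u}} (f : C ⟶ D) (g : D ⟶ E) (n : ℕ) :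
    Hom.app (f ≫ g) n = Hom.app f n ≫ Hom.app g n := rfl

/-- A homomorphism of computads is generator-preserving if all its truncations are. -/
def GenPres {C D : Comp.{u}} (f : C ⟶ D) : Prop := ∀ n : ℕ, (stage.{u} n).genPres (Hom.app f n)

/-- The `n`-cells of a computad. -/
abbrev Cells (C : Comp.{u}) (n : ℕ) : Type u := (stage.{u} n).cell (C.obj n)

/-- The boundary sphere of an `(n+1)`-cell of a computad. -/
def bdry (C : Comp.{u}) {n : ℕ} (c : C.Cells (n + 1)) : (stage.{u} n).sph (C.obj n) :=
  (stage.{u} n).sphMap (eqToHom (C.trunc_obj n)) (cellTy c)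

theorem bdry_map {C D : Comp.{u}} (f : C ⟶ D) {n : ℕ} (c : C.Cells (n + 1)) :
    D.bdry ((stage.{u} (n + 1)).cellMap (Hom.app f (n + 1)) c) =
      (stage.{u} n).sphMap (Hom.app f n) (C.bdry c) := by
  unfold bdry
  rw [cellTy_map, ← Stage.sphMap_comp, ← Stage.sphMap_comp, Hom.trunc_map]


theorem bdry_fst (C : Comp.{u}) {n : ℕ} (A : (stage.{u} (n + 1)).sph (C.obj (n + 1))) :
    C.bdry ((stage.{u} (n + 1)).fst A) = C.bdry ((stage.{u} (n + 1)).snd A) :=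
  congrArg ((stage.{u} n).sphMap (eqToHom (C.trunc_obj n))) (cellTy_fst A)

/-- The globular set of cells of a computad. -/
@[reducible]
def cellGlob (C : Comp.{u}) : Glob.{u} where
  cell := C.Cells
  src c := (stage.{u} _).fst (C.bdry c)
  tgt c := (stage.{u} _).snd (C.bdry c)
  src_src c := congrArg (stage.{u} _).fst (C.bdry_fst (C.bdry c))
  tgt_src c := congrArg (stage.{u} _).snd (C.bdry_fst (C.bdry c))

end Comp

/-- The functor sending a computad to its globular set of cells. -/
@[reducible]
def cells : Comp.{u} ⥤ Glob.{u} where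
  obj C := C.cellGlob
  map f :=
    { app := fun n => (stage.{u} n).cellMap (Comp.Hom.app f n)
      app_src := fun c => ((stage.{u} _).fst_map _ _).symm.trans
        (congrArg (stage.{u} _).fst (Comp.bdry_map f c).symm)
      app_tgt := fun c => ((stage.{u} _).snd_map _ _).symm.trans
        (congrArg (stage.{u} _).snd (Comp.bdry_map f c).symm) }
  map_id _ := Glob.hom_ext fun n x => (stage.{u} n).cellMap_id x
  map_comp _ _ := Glob.hom_ext fun n x => (stage.{u} n).cellMap_comp _ _ x

/-- The free computad on a globular set, as a functor. -/
@[reducible]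
def freeComputad : Glob.{u} ⥤ Comp.{u} where
  obj X := ⟨fun n => (stage.{u} n).free.obj X, fun _ => rfl⟩
  map f := ⟨fun n => (stage.{u} n).free.map f, fun n =>
    (Category.comp_id ((stage.{u} n).free.map f)).trans (Category.id_comp _).symm⟩
  map_id X := Comp.Hom.ext (funext fun n => (stage.{u} n).free.map_id X)
  map_comp f g := Comp.Hom.ext (funext fun n => (stage.{u} n).free.map_comp f g)

/-! ### The free computad adjunction and its monad -/

theorem free_zero_hom_ext {X : Glob.{u}} {C : (stage.{u} 0).Obj}
    {f g : (stage.{u} 0).free.obj X ⟶ C}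
    (h : ∀ x : X.cell 0, (stage.{u} 0).cellMap f ((stage.{u} 0).gen X x) =
      (stage.{u} 0).cellMap g ((stage.{u} 0).gen X x)) : f = g :=
  TypeCat.Hom.ext (TypeCat.Fun.ext (funext h))

theorem free_succ_hom_ext {n : ℕ} {X : Glob.{u}} {C : (stage.{u} (n + 1)).Obj}
    {f g : (stage.{u} (n + 1)).free.obj X ⟶ C} (h₀ : (trunc n).map f = (trunc n).map g)
    (h : ∀ x : X.cell (n + 1), (stage.{u} (n + 1)).cellMap f ((stage.{u} (n + 1)).gen X x) =
      (stage.{u} (n + 1)).cellMap g ((stage.{u} (n + 1)).gen X x)) : f = g :=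
  Stage.SHom.ext h₀ (funext h)

theorem free_hom_ext {X : Glob.{u}} {C : Comp.{u}} {f g : freeComputad.obj X ⟶ C}
    (h : ∀ (n : ℕ) (x : X.cell n),
      (stage.{u} n).cellMap (Comp.Hom.app f n) ((stage.{u} n).gen X x) =
        (stage.{u} n).cellMap (Comp.Hom.app g n) ((stage.{u} n).gen X x)) : f = g := by
  refine Comp.Hom.ext (funext fun n => ?_)
  induction n with
  | zero => exact free_zero_hom_ext (h 0)
  | succ n ih =>
    refine free_succ_hom_ext ?_ (h (n + 1))
    rw [← cancel_mono (eqToHom (C.trunc_obj n)), Comp.Hom.trunc_map, Comp.Hom.trunc_map, ih]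

theorem bdry_gen (X : Glob.{u}) {n : ℕ} (x : X.cell (n + 1)) :
    (freeComputad.obj X).bdry ((stage.{u} (n + 1)).gen X x) =
      (stage.{u} n).posSph X (X.src x) (X.tgt x) (X.parallel_src_tgt x) :=
  (stage.{u} n).sphMap_id _

/-- The inclusion of the cells of a globular set as generators of the free computad on it. -/
def unitApp (X : Glob.{u}) : X ⟶ cells.obj (freeComputad.obj X) where
  app n x := (stage.{u} n).gen X x
  app_src x := by
    refine Eq.trans ?_ (congrArg (stage.{u} _).fst (bdry_gen X x)).symm
    rw [Stage.fst_posSph]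
  app_tgt x := by
    refine Eq.trans ?_ (congrArg (stage.{u} _).snd (bdry_gen X x)).symm
    rw [Stage.snd_posSph]

/-- Extension of an `n`-homomorphism out of a free `n`-computad. -/
def liftSucc {n : ℕ} {X : Glob.{u}} {C : (stage.{u} (n + 1)).Obj}
    (f : (stage.{u} n).free.obj X ⟶ (trunc n).obj C)
    (g : X.cell (n + 1) → (stage.{u} (n + 1)).cell C)
    (h : ∀ x, cellTy (g x) = (stage.{u} n).sphMap f
      ((stage.{u} n).posSph X (X.src x) (X.tgt x) (X.parallel_src_tgt x))) :
    (stage.{u} (n + 1)).free.obj X ⟶ C :=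
  Stage.SHom.mk f g h

theorem sphMap_eqToHom {n : ℕ} {C D : (stage.{u} n).Obj} (h : C = D) (c : (stage.{u} n).sph D) :
    (stage.{u} n).sphMap (eqToHom h) ((stage.{u} n).sphMap (eqToHom h.symm) c) = c := by
  subst h
  simp only [eqToHom_refl, Stage.sphMap_id]

theorem lift_comm {X : Glob.{u}} {C : Comp.{u}} (g : X ⟶ cells.obj C) {n : ℕ}
    (f : (stage.{u} n).free.obj X ⟶ C.obj n)
    (hf : ∀ x : X.cell n, (stage.{u} n).cellMap f ((stage.{u} n).gen X x) = Glob.Hom.app g n x)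
    (x : X.cell (n + 1)) :
    cellTy (Glob.Hom.app g (n + 1) x : C.Cells (n + 1)) =
      (stage.{u} n).sphMap (f ≫ eqToHom (C.trunc_obj n).symm)
        ((stage.{u} n).posSph X (X.src x) (X.tgt x) (X.parallel_src_tgt x)) := by
  have key : C.bdry (Glob.Hom.app g (n + 1) x) = (stage.{u} n).sphMap f
      ((stage.{u} n).posSph X (X.src x) (X.tgt x) (X.parallel_src_tgt x)) := by
    apply Stage.sph_ext
    · rw [Stage.fst_map, Stage.fst_posSph, hf, g.app_src]
    · rw [Stage.snd_map, Stage.snd_posSph, hf, g.app_tgt]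
  rw [Stage.sphMap_comp, ← key]
  exact (sphMap_eqToHom (C.trunc_obj n).symm _).symm

/-- The components of the homomorphism out of a free computad with given values on generators. -/
def liftAux {X : Glob.{u}} {C : Comp.{u}} (g : X ⟶ cells.obj C) : ∀ n : ℕ,
    {f : (stage.{u} n).free.obj X ⟶ C.obj n // ∀ x : X.cell n,
      (stage.{u} n).cellMap f ((stage.{u} n).gen X x) = Glob.Hom.app g n x}
  | 0 => ⟨↾(Glob.Hom.app g 0), fun _ => rfl⟩
  | n + 1 => ⟨liftSucc ((liftAux g n).1 ≫ eqToHom (C.trunc_obj n).symm) (Glob.Hom.app g (n + 1))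
      (lift_comm g (liftAux g n).1 (liftAux g n).2), fun _ => rfl⟩

/-- The homomorphism out of a free computad with given values on generators. -/
def lift {X : Glob.{u}} {C : Comp.{u}} (g : X ⟶ cells.obj C) : freeComputad.obj X ⟶ C where
  app n := (liftAux g n).1
  trunc_map n := by
    have h : (trunc n).map (liftAux g (n + 1)).1 =
      (liftAux g n).1 ≫ eqToHom (C.trunc_obj n).symm := rfl
    have h' : ((liftAux g n).1 ≫ eqToHom (C.trunc_obj n).symm) ≫ eqToHom (C.trunc_obj n) =
      (liftAux g n).1 := by simp
    exact (congrArg (· ≫ eqToHom (C.trunc_obj n)) h).trans (h'.trans (Category.id_comp _).symm)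

theorem lift_gen {X : Glob.{u}} {C : Comp.{u}} (g : X ⟶ cells.obj C) (n : ℕ) (x : X.cell n) :
    (stage.{u} n).cellMap (Comp.Hom.app (lift g) n) ((stage.{u} n).gen X x) = Glob.Hom.app g n x :=
  (liftAux g n).2 x

/-- The free computad adjunction. -/
def freeAdj : freeComputad.{u} ⊣ cells.{u} :=
  Adjunction.mkOfHomEquiv
    { homEquiv := fun X C =>
        { toFun := fun f => unitApp X ≫ cells.map f
          invFun := lift
          left_inv := fun f => free_hom_ext fun n x => lift_gen _ n x
          right_inv := fun g => Glob.hom_ext fun n x => lift_gen g n x }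
      homEquiv_naturality_left_symm := fun {X' X C} f g => free_hom_ext fun n x => by
        rw [Equiv.coe_fn_symm_mk, lift_gen, Comp.comp_app, Stage.cellMap_comp]
        refine Eq.trans ?_ (congrArg ((stage.{u} n).cellMap (Comp.Hom.app (lift g) n))
          ((stage.{u} n).gen_map f x)).symm
        rw [lift_gen]
        rfl
      homEquiv_naturality_right := fun f g => by
        rw [Equiv.coe_fn_mk, Equiv.coe_fn_mk, Functor.map_comp, Category.assoc] }

/-- The free weak `ω`-category monad on globular sets. -/
def fcw : Monad Glob.{u} := freeAdj.{u}.toMonad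

/-! ### Generic homomorphisms -/

/-- A homomorphism between free computads is generic if it has the unique left lifting property
against generator-preserving homomorphisms of free computads, for squares whose bottom side is
generator-preserving. -/
def Generic {X Y : Glob.{u}} (σ : freeComputad.obj X ⟶ freeComputad.obj Y) : Prop :=
  ∀ (Z W : Glob.{u}) (τ : freeComputad.obj X ⟶ freeComputad.obj Z) (f : freeComputad.obj Y ⟶ freeComputad.obj W)
    (g : freeComputad.obj Z ⟶ freeComputad.obj W), Comp.GenPres f → Comp.GenPres g → σ ≫ f = τ ≫ g →
    ∃! h : freeComputad.obj Y ⟶ freeComputad.obj Z, σ ≫ h = τ ∧ h ≫ g = f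

/-- `(B', gen, fr)` is a (generic, generator-preserving) factorisation of `σ` through the free
computad on a Batanin tree. -/
def IsGenericFreeFactorisation {B : Bat} {X : Glob.{u}} (σ : freeComputad.obj (pos B) ⟶ freeComputad.obj X)
    (F : Σ B' : Bat, (freeComputad.obj (pos B) ⟶ freeComputad.obj (pos B')) × (freeComputad.obj (pos B') ⟶ freeComputad.obj X)) :
    Prop :=
  Generic F.2.1 ∧ Comp.GenPres F.2.2 ∧ F.2.1 ≫ F.2.2 = σ

/-! ### Monads with arities -/

section Arities

variable {A : Type u₁} [Category.{v₁} A] {E : Type u₂} [Category.{v₂} E]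

/-- The canonical cocone on the diagram of all objects of `A` over `X`. -/
def canonicalCocone (i : A ⥤ E) (X : E) : Cocone (CostructuredArrow.proj i X ⋙ i) where
  pt := X
  ι :=
    { app := fun a => a.hom
      naturality := fun _ _ φ => (CostructuredArrow.w φ).trans (Category.comp_id _).symm }

/-- The nerve functor `X ↦ E(i -, X)`. -/
def nerve (i : A ⥤ E) : E ⥤ Aᵒᵖ ⥤ Type v₂ := yoneda ⋙ (Functor.whiskeringLeft _ _ _).obj i.op

/-- The monad `T` has arities in the full subcategory `i : A ⥤ E`: the subcategory is dense, and
the nerve functor composed with `T` sends the canonical cocones to colimit cocones. -/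
structure HasArities (i : A ⥤ E) (T : Monad E) : Prop where
  full : i.Full
  faithful : i.Faithful
  dense : ∀ X : E, Nonempty (IsColimit (canonicalCocone i X))
  nerve_preserves : ∀ X : E,
    Nonempty (IsColimit ((T.toFunctor ⋙ nerve i).mapCocone (canonicalCocone i X)))

end Arities

/-- The full subcategory of globular sets on the globular sets of positions of Batanin trees. -/
abbrev Theta₀ : Type := InducedCategory Glob.{u} (pos.{u})

end Computads

open Computads

-- Homomorphisms out of the free computad on a disk are cells (`cellHom`), and generator-preserving
-- homomorphisms between free computads are exactly the `freeComputad.map g` (`genPres_iff`). The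
-- factorisation in (1) is built first for single cells, by induction on cells. A generator is an
-- identity followed by a globular map. For a coherence cell given by `τ`, factor `τ` as `τ'`
-- followed by `f`; the coherence cell given by `τ'`, followed by `f`, factors the original one. It
-- is generic because generator-preserving maps create coherence cells (`eq_coh_of_act_map`), so
-- that lifting it is the same as lifting `τ'` (`good_coh`).
--
-- To pass from cells to trees, every tree is an iterated pasting of disks along boundaries
-- (`built`), and pasting squares are pushouts. The factorisations of two pieces restrict to generic
-- factorisations over the common boundary. These are equal by uniqueness, so the middle trees share
-- a boundary and can be pasted (`exists_pasteSq`, `PasteSq.hasGood`). The induction must therefore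
-- carry boundaries along, which is the role of `Good`. For a coherence cell they come from
-- fullness: each face of a full sphere has maximal support in the corresponding boundary of the
-- tree, hence has its middle tree equal to that boundary (`exists_good_of_full`). The support
-- clause of `Core` makes this comparison possible and also yields the dimension bound.
--
-- Uniqueness is literal equality because trees are rigid. The relations `src x < x < tgt x`
-- generate a linear order on positions, preserved by all morphisms; hence morphisms are injective,
-- and the image determines both the source tree and the morphism (`Pos.eq_of_image_eq`). Two
-- generic factorisations are compared by a map with a section, hence surjective, hence an identity
-- (`generic_factorisation_unique`).
--
-- For (2), density holds already because disks represent cells. The nerve condition is checked at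
-- each tree `B`: by (1) and adjunction, an element over `X` comes from a generic homomorphism into
-- some tree over `X`, and this representative maps to every other one.

namespace Computads

/-! ### Faces and boundaries of globular sets -/

namespace Glob

/-- The source (`ε = false`) or target (`ε = true`) of a cell. -/
def face (X : Glob.{u}) (ε : Bool) {n : ℕ} (x : X.cell (n + 1)) : X.cell n :=
  bif ε then X.tgt x else X.src x

theorem face_face (X : Glob.{u}) (δ ε ε' : Bool) {n : ℕ} (x : X.cell (n + 2)) :
    X.face δ (X.face ε x) = X.face δ (X.face ε' x) := by
  have h₁ := X.src_src x
  have h₂ := X.tgt_src x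
  cases δ <;> cases ε <;> cases ε' <;> simp [face, h₁, h₂]

theorem app_face {X Y : Glob.{u}} (f : X ⟶ Y) (ε : Bool) {n : ℕ} (x : X.cell (n + 1)) :
    Hom.app f n (X.face ε x) = Y.face ε (Hom.app f (n + 1) x) := by
  cases ε
  · exact f.app_src x
  · exact f.app_tgt x

/-- A morphism from a family of maps that commutes with faces. -/
def homMk {X Y : Glob.{u}} (f : ∀ n, X.cell n → Y.cell n)
    (h : ∀ (ε : Bool) (n : ℕ) (x : X.cell (n + 1)), f n (X.face ε x) = Y.face ε (f (n + 1) x)) :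
    X ⟶ Y :=
  Hom.mk f (fun x => h false _ x) (fun x => h true _ x)

/-- The `n`-cells of the `ε`-boundary of dimension `k`: all of them for `n < k`, those that are not
an opposite face for `n = k`, and none for `n > k`. -/
def bd (X : Glob.{u}) (ε : Bool) (k n : ℕ) : Set (X.cell n) :=
  {x | n ≤ k ∧ (n = k → ∀ y, X.face (!ε) y ≠ x)}

/-- The image of a morphism is the `ε`-boundary of dimension `k` of its target. -/
def IsBd {X Y : Glob.{u}} (f : X ⟶ Y) (ε : Bool) (k : ℕ) : Prop :=
  ∀ (n : ℕ) (y : Y.cell n), (∃ x, Hom.app f n x = y) ↔ y ∈ Y.bd ε k n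

/-- The globular set of cells of positive dimension. -/
def shift (X : Glob.{u}) : Glob.{u} where
  cell n := X.cell (n + 1)
  src := X.src
  tgt := X.tgt
  src_src := X.src_src
  tgt_src := X.tgt_src

/-- Cellwise injective morphisms. -/
def Inj {X Y : Glob.{u}} (f : X ⟶ Y) : Prop := ∀ n, Function.Injective (Hom.app f n)

theorem exists_lift {X Y Z : Glob.{u}} (f : X ⟶ Z) (g : Y ⟶ Z) (hg : Inj g)
    (h : ∀ n x, ∃ y, Hom.app g n y = Hom.app f n x) : ∃ k : X ⟶ Y, k ≫ g = f := by
  choose k hk using h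
  refine ⟨homMk k fun ε n x => hg _ ?_, hom_ext hk⟩
  rw [app_face, hk, hk, app_face]

theorem Inj.cancel {X Y Z : Glob.{u}} {f f' : X ⟶ Y} {g : Y ⟶ Z} (hg : Inj g)
    (h : f ≫ g = f' ≫ g) : f = f' :=
  hom_ext fun n x => hg n (by rw [← comp_app, h, comp_app])

end Glob

/-! ### Positions of a Batanin tree -/

namespace Bat

/-- Peels off the first branch, matching the constructors `inl` and `inr` of positions; it avoids
the nested recursor of `Bat` later on. -/
theorem ind {P : Bat → Prop} (nil : P (.br []))
    (cons : ∀ B L, P B → P (.br L) → P (.br (B :: L))) (B : Bat) : P B :=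
  Bat.rec (motive_1 := P) (motive_2 := fun L => P (.br L)) (fun _ h => h) nil
    (fun B L hB hL => cons B L hB hL) B

theorem dim_nil : (Bat.br []).dim = 0 := by simp [dim, dimList]

theorem dim_cons (B : Bat) (L : List Bat) :
    (Bat.br (B :: L)).dim = max (B.dim + 1) (Bat.br L).dim := by simp [dim, dimList]

mutual
/-- The dimensions of the positions of a tree, in their linear order. -/
def dims : Bat → List ℕ
  | .br L => dimsList L
/-- Auxiliary: the dimensions of the positions of `br L`. -/
def dimsList : List Bat → List ℕ
  | [] => [0]
  | B :: L => 0 :: (B.dims.map Nat.succ ++ dimsList L)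
end

theorem dims_nil : (Bat.br []).dims = [0] := by simp [dims, dimsList]

theorem dims_cons (B : Bat) (L : List Bat) :
    (Bat.br (B :: L)).dims = 0 :: (B.dims.map Nat.succ ++ (Bat.br L).dims) := by
  simp [dims, dimsList]

theorem dims_head (B : Bat) : ∃ l, B.dims = 0 :: l := by
  obtain ⟨_ | ⟨B, L⟩⟩ := B
  · exact ⟨_, dims_nil⟩
  · exact ⟨_, dims_cons B L⟩

/-- The displayed `0` is the first zero of the list, since all entries before it are successors, so
it marks where to cut. -/
theorem append_zero_inj : ∀ {s s' t t' : List ℕ},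
    s.map Nat.succ ++ 0 :: t = s'.map Nat.succ ++ 0 :: t' → s = s' ∧ t = t'
  | [], [], _, _, h => ⟨rfl, by simpa using h⟩
  | [], _ :: _, _, _, h => by simp at h
  | _ :: _, [], _, _, h => by simp at h
  | a :: s, b :: s', _, _, h => by
    simp only [List.map_cons, List.cons_append, List.cons.injEq, Nat.succ.injEq] at h
    obtain ⟨h₁, h₂⟩ := append_zero_inj h.2
    exact ⟨by rw [h.1, h₁], h₂⟩

/-- After the leading `0`, the next zero opens the dimension list of the remaining branches; what
lies between is the shifted list of the first branch. -/
theorem dims_injective (B : Bat) : ∀ B' : Bat, B.dims = B'.dims → B = B' := by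
  induction B using Bat.ind with
  | nil =>
    rintro ⟨_ | ⟨B', L'⟩⟩ h
    · rfl
    · obtain ⟨l, hl⟩ := dims_head (.br L')
      rw [dims_nil, dims_cons, hl] at h
      simp at h
  | cons B L hB hL =>
    rintro ⟨_ | ⟨B', L'⟩⟩ h
    · obtain ⟨l, hl⟩ := dims_head (.br L)
      rw [dims_nil, dims_cons, hl] at h
      simp at h
    · obtain ⟨l, hl⟩ := dims_head (.br L)
      obtain ⟨l', hl'⟩ := dims_head (.br L')
      rw [dims_cons, dims_cons, hl, hl', List.cons.injEq] at h
      obtain ⟨h₁, h₂⟩ := append_zero_inj h.2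
      have := hL (.br L') (by rw [hl, hl', h₂])
      rw [hB B' h₁, Bat.br.inj this]

end Bat

namespace Pos

theorem le_dim : ∀ {B : Bat} {n : ℕ}, Pos.{u} B n → n ≤ B.dim
  | _, _, .here _ => Nat.zero_le _
  | _, _, .inr B L p => by
    rw [Bat.dim_cons]
    exact (le_dim p).trans (le_max_right _ _)
  | _, _, .inl B L q => by
    rw [Bat.dim_cons]
    exact (Nat.succ_le_succ (le_dim q)).trans (le_max_left _ _)

theorem nonempty_dim (B : Bat) : Nonempty (Pos.{u} B B.dim) := by
  induction B using Bat.ind with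
  | nil => rw [Bat.dim_nil]; exact ⟨.here _⟩
  | cons B L hB hL =>
    rw [Bat.dim_cons]
    obtain h | h := max_choice (B.dim + 1) (Bat.br L).dim <;> rw [h]
    · exact hB.map (.inl B L)
    · exact hL.map (.inr B L)

/-- The place of a position in the linear order of all positions. -/
def idx : ∀ {B : Bat} {n : ℕ}, Pos.{u} B n → ℕ
  | _, _, .here _ => 0
  | _, _, .inr B _ p => 1 + B.dims.length + idx p
  | _, _, .inl _ _ q => 1 + idx q

theorem idx_lt : ∀ {B : Bat} {n : ℕ} (p : Pos.{u} B n), idx p < B.dims.length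
  | B, _, .here _ => by
    obtain ⟨l, hl⟩ := B.dims_head
    simp [idx, hl]
  | _, _, .inr B L p => by
    have := idx_lt p
    simp only [idx, Bat.dims_cons, List.length_cons, List.length_append, List.length_map]
    omega
  | _, _, .inl B L q => by
    have := idx_lt q
    simp only [idx, Bat.dims_cons, List.length_cons, List.length_append, List.length_map]
    omega

theorem idx_src : ∀ {B : Bat} {n : ℕ} (p : Pos.{u} B (n + 1)), idx p.src < idx p
  | _, _, .inr B L p => by simpa [src_inr, idx] using idx_src p
  | _, 0, .inl B L q => by simp [src_inl_zero, idx]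
  | _, _ + 1, .inl B L q => by simpa [src_inl_succ, idx] using idx_src q

theorem idx_tgt : ∀ {B : Bat} {n : ℕ} (p : Pos.{u} B (n + 1)), idx p < idx p.tgt
  | _, _, .inr B L p => by simpa [tgt_inr, idx] using idx_tgt p
  | _, 0, .inl B L q => by
    have := idx_lt q
    simp only [tgt_inl_zero, idx]
    omega
  | _, _ + 1, .inl B L q => by simpa [tgt_inl_succ, idx] using idx_tgt q

/-- The generating relation `src x < x < tgt x` of the linear order on positions. -/
inductive Step {B : Bat} : (Σ n, Pos.{u} B n) → (Σ n, Pos.{u} B n) → Prop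
  | src {n : ℕ} (p : Pos.{u} B (n + 1)) : Step ⟨n, p.src⟩ ⟨n + 1, p⟩
  | tgt {n : ℕ} (p : Pos.{u} B (n + 1)) : Step ⟨n + 1, p⟩ ⟨n, p.tgt⟩

theorem Step.idx_lt {B : Bat} {x y : Σ n, Pos.{u} B n} (h : Step x y) : x.2.idx < y.2.idx := by
  cases h with
  | src p => exact idx_src p
  | tgt p => exact idx_tgt p

/-- The action of a morphism on positions of all dimensions. -/
def sigmaMap {B B' : Bat} (f : pos.{u} B ⟶ pos.{u} B') (x : Σ n, Pos.{u} B n) :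
    Σ n, Pos.{u} B' n := ⟨x.1, Glob.Hom.app f x.1 x.2⟩

theorem Step.map {B B' : Bat} (f : pos.{u} B ⟶ pos.{u} B') {x y : Σ n, Pos.{u} B n}
    (h : Step x y) : Step (sigmaMap f x) (sigmaMap f y) := by
  cases h with
  | src p =>
    have := Step.src (Glob.Hom.app f _ p)
    rwa [show (Glob.Hom.app f _ p : Pos B' _).src = Glob.Hom.app f _ p.src from
      (f.app_src p).symm] at this
  | tgt p =>
    have := Step.tgt (Glob.Hom.app f _ p)
    rwa [show (Glob.Hom.app f _ p : Pos B' _).tgt = Glob.Hom.app f _ p.tgt from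
      (f.app_tgt p).symm] at this

/-- `inl` on positions of all dimensions. -/
def sigmaInl (B : Bat) (L : List Bat) (x : Σ n, Pos.{u} B n) : Σ n, Pos.{u} (.br (B :: L)) n :=
  ⟨x.1 + 1, .inl B L x.2⟩

/-- `inr` on positions of all dimensions. -/
def sigmaInr (B : Bat) (L : List Bat) (x : Σ n, Pos.{u} (.br L) n) :
    Σ n, Pos.{u} (.br (B :: L)) n :=
  ⟨x.1, .inr B L x.2⟩

theorem Step.inl {B : Bat} {L : List Bat} {x y : Σ n, Pos.{u} B n} (h : Step x y) :
    Step (sigmaInl B L x) (sigmaInl B L y) := by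
  cases h with
  | src p => exact Step.src (Pos.inl B L p)
  | tgt p => exact Step.tgt (Pos.inl B L p)

theorem Step.inr {B : Bat} {L : List Bat} {x y : Σ n, Pos.{u} (.br L) n} (h : Step x y) :
    Step (sigmaInr B L x) (sigmaInr B L y) := by
  cases h with
  | src p => exact Step.src (Pos.inr B L p)
  | tgt p => exact Step.tgt (Pos.inr B L p)

/-- The list of all positions in their linear order. -/
theorem exists_enum (B : Bat) : ∃ l : List (Σ n, Pos.{u} B n),
    (∀ x, x ∈ l) ∧ l.IsChain Step ∧ l.map Sigma.fst = B.dims ∧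
      (∃ t, l = ⟨0, .here B⟩ :: t) ∧ ∃ s p, l = s ++ [⟨0, p⟩] := by
  induction B using Bat.ind with
  | nil =>
    refine ⟨[⟨0, .here _⟩], ?_, by simp, by simp [Bat.dims_nil], ⟨[], rfl⟩, [], _, rfl⟩
    rintro ⟨n, p⟩
    cases p
    simp
  | cons B L hB hL =>
    obtain ⟨l, hl, hc, hd, ⟨t, ht⟩, s, p, hs⟩ := hB
    obtain ⟨l', hl', hc', hd', ⟨t', ht'⟩, s', p', hs'⟩ := hL
    refine ⟨⟨0, .here _⟩ :: (l.map (sigmaInl B L) ++ l'.map (sigmaInr B L)), ?_, ?_, ?_, ?_, ?_⟩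
    · rintro ⟨n, q⟩
      simp only [List.mem_cons, List.mem_append, List.mem_map]
      cases q with
      | here => exact .inl rfl
      | inl _ _ q => exact .inr (.inl ⟨_, hl ⟨_, q⟩, rfl⟩)
      | inr _ _ q => exact .inr (.inr ⟨_, hl' ⟨_, q⟩, rfl⟩)
    · have h₁ : (l.map (sigmaInl B L)).IsChain Step :=
        (List.isChain_map _).2 (hc.imp fun _ _ h => h.inl)
      have h₂ : (l'.map (sigmaInr B L)).IsChain Step :=
        (List.isChain_map _).2 (hc'.imp fun _ _ h => h.inr)
      rw [List.isChain_cons]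
      -- The two junctions explain the clauses on the ends of the list: `here` is the source of `inl
      -- here`, and as the last position of `B` has dimension `0`, its `inl` has target `inr here`.
      refine ⟨?_, List.IsChain.append h₁ h₂ ?_⟩
      · rw [ht]
        rintro y hy
        simp only [List.map_cons, List.cons_append, List.head?_cons, Option.mem_def,
          Option.some.injEq] at hy
        subst hy
        exact Step.src (Pos.inl B L (.here B))
      · rw [hs, ht']
        rintro x hx y hy
        simp only [List.map_append, List.map_cons, List.map_nil, List.getLast?_append,
          List.getLast?_singleton, Option.some_or, Option.mem_def, Option.some.injEq] at hx
        simp only [List.map_cons, List.head?_cons, Option.mem_def, Option.some.injEq] at hy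
        subst hx hy
        exact Step.tgt (Pos.inl B L p)
    · rw [Bat.dims_cons, ← hd, ← hd']
      simp [sigmaInl, sigmaInr, Function.comp_def]
    · exact ⟨_, rfl⟩
    · exact ⟨⟨0, .here _⟩ :: (l.map (sigmaInl B L) ++ s'.map (sigmaInr B L)), .inr B L p', by
        rw [hs']; simp [sigmaInr]⟩

/-- Each step raises `idx`, so a chain of steps is strictly sorted: it has no repetitions and is
determined by its set of members. -/
theorem pairwise_idx {B : Bat} {l : List (Σ n, Pos.{u} B n)} (h : l.IsChain Step) :
    l.Pairwise fun x y => x.2.idx < y.2.idx := by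
  have hl := (h.imp fun _ _ h => h.idx_lt : l.IsChain fun x y => x.2.idx < y.2.idx)
  have : IsTrans (Σ n, Pos.{u} B n) fun x y => x.2.idx < y.2.idx := ⟨fun _ _ _ => lt_trans⟩
  exact hl.pairwise

/-- Morphisms preserve `Step`, so both image lists are strictly sorted by `idx`; having the same
members, they coincide. -/
theorem map_eq_map_of_image_eq {P Q B : Bat} (f : pos.{u} P ⟶ pos.{u} B) (g : pos.{u} Q ⟶ pos.{u} B)
    (h : ∀ n y, (∃ x, Glob.Hom.app f n x = y) ↔ ∃ x, Glob.Hom.app g n x = y)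
    {l : List (Σ n, Pos.{u} P n)} {l' : List (Σ n, Pos.{u} Q n)} (hl : ∀ x, x ∈ l)
    (hl' : ∀ x, x ∈ l') (hc : l.IsChain Step) (hc' : l'.IsChain Step) :
    l.map (sigmaMap f) = l'.map (sigmaMap g) := by
  have h₁ := pairwise_idx ((List.isChain_map (sigmaMap f)).2 (hc.imp fun _ _ h => h.map f))
  have h₂ := pairwise_idx ((List.isChain_map (sigmaMap g)).2 (hc'.imp fun _ _ h => h.map g))
  have n₁ : (l.map (sigmaMap f)).Nodup := h₁.imp fun hab e => absurd hab (by rw [e]; exact lt_irrefl _)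
  have n₂ : (l'.map (sigmaMap g)).Nodup := h₂.imp fun hab e => absurd hab (by rw [e]; exact lt_irrefl _)
  refine List.Perm.eq_of_pairwise (fun a b _ _ hab hba => absurd hab (lt_asymm hba)) h₁ h₂ ?_
  rw [List.perm_ext_iff_of_nodup n₁ n₂]
  rintro ⟨n, y⟩
  constructor
  · intro hy
    obtain ⟨⟨m, x⟩, -, hx⟩ := List.mem_map.1 hy
    cases hx
    obtain ⟨z, hz⟩ := (h m _).1 ⟨x, rfl⟩
    exact List.mem_map.2 ⟨⟨m, z⟩, hl' _, by rw [sigmaMap, hz]⟩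
  · intro hy
    obtain ⟨⟨m, x⟩, -, hx⟩ := List.mem_map.1 hy
    cases hx
    obtain ⟨z, hz⟩ := (h m _).2 ⟨x, rfl⟩
    exact List.mem_map.2 ⟨⟨m, z⟩, hl _, by rw [sigmaMap, hz]⟩

/-- Every morphism between globular sets of positions is injective. -/
theorem inj {P B : Bat} (f : pos.{u} P ⟶ pos.{u} B) : Glob.Inj f := by
  intro n x y hxy
  obtain ⟨l, hl, hc, -⟩ := exists_enum.{u} P
  have h₁ := pairwise_idx ((List.isChain_map (sigmaMap f)).2 (hc.imp fun _ _ h => h.map f))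
  have n₁ : (l.map (sigmaMap f)).Nodup := h₁.imp fun hab e => absurd hab (by rw [e]; exact lt_irrefl _)
  have := List.inj_on_of_nodup_map n₁ (hl ⟨n, x⟩) (hl ⟨n, y⟩) (by simp only [sigmaMap, hxy])
  simpa using this

/-- A morphism between globular sets of positions is determined by its image. -/
theorem eq_of_image_eq {P Q B : Bat} (f : pos.{u} P ⟶ pos.{u} B) (g : pos.{u} Q ⟶ pos.{u} B)
    (h : ∀ n y, (∃ x, Glob.Hom.app f n x = y) ↔ ∃ x, Glob.Hom.app g n x = y) :
    (⟨P, f⟩ : Σ P : Bat, (pos.{u} P ⟶ pos.{u} B)) = ⟨Q, g⟩ := by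
  obtain ⟨l, hl, hc, hd, -⟩ := exists_enum.{u} P
  obtain ⟨l', hl', hc', hd', -⟩ := exists_enum.{u} Q
  have key := map_eq_map_of_image_eq f g h hl hl' hc hc'
  -- Morphisms preserve dimension, so equality of the image lists gives equal dimension lists, which
  -- determine the trees.
  obtain rfl : P = Q := by
    apply Bat.dims_injective
    rw [← hd, ← hd']
    simpa [sigmaMap, Function.comp_def] using congrArg (List.map Sigma.fst) key
  -- The case of identities shows that the two chosen enumerations of `P` are the same list.
  have hid : sigmaMap (𝟙 (pos.{u} P)) = id := rfl
  have hll := map_eq_map_of_image_eq (𝟙 (pos.{u} P)) (𝟙 (pos.{u} P)) (fun _ _ => Iff.rfl) hl hl' hc hc'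
  rw [hid, List.map_id, List.map_id] at hll
  subst hll
  congr 1
  refine Glob.hom_ext fun n x => ?_
  have := List.map_inj_left.1 key ⟨n, x⟩ (hl _)
  simpa [sigmaMap] using this

end Pos

-- Boundaries of trees, and morphisms out of `br (B :: L)`

namespace Pos

theorem face_inr (B : Bat) (L : List Bat) (ε : Bool) {n : ℕ} (p : Pos.{u} (.br L) (n + 1)) :
    (pos.{u} (.br (B :: L))).face ε (.inr B L p : Pos.{u} (.br (B :: L)) (n + 1)) =
      .inr B L ((pos.{u} (.br L)).face ε p) := by
  cases ε <;> rfl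

theorem face_inl (B : Bat) (L : List Bat) (ε : Bool) {n : ℕ} (q : Pos.{u} B (n + 1)) :
    (pos.{u} (.br (B :: L))).face ε (.inl B L q : Pos.{u} (.br (B :: L)) (n + 2)) =
      .inl B L ((pos.{u} B).face ε q) := by
  cases ε <;> rfl

theorem face_true_ne_here (B : Bat) (q : Pos.{u} B 1) : (pos.{u} B).face true q ≠ .here B := by
  cases q with
  | inr B L p => exact fun h => by rw [face_inr] at h; cases h
  | inl B L q => exact fun h => by cases h

theorem eq_here_or_face (B : Bat) : ∀ p : Pos.{u} B 0,
    p = .here B ∨ ∃ q : Pos.{u} B 1, (pos.{u} B).face true q = p := by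
  induction B using Bat.ind with
  | nil => intro p; cases p; exact .inl rfl
  | cons B L _ ih =>
    intro p
    cases p with
    | here => exact .inl rfl
    | inr _ _ p =>
      obtain rfl | ⟨q, rfl⟩ := ih p
      · exact .inr ⟨.inl B L (.here B), rfl⟩
      · exact .inr ⟨.inr B L q, face_inr _ _ _ _⟩

/-- The boundary of dimension `0` is a single position. -/
theorem exists_bd_zero (B : Bat) (ε : Bool) :
    ∃ p : Pos.{u} B 0, ∀ q : Pos.{u} B 0, q ∈ (pos.{u} B).bd ε 0 0 ↔ q = p := by
  cases ε with
  | false =>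
    refine ⟨.here B, fun q => ⟨fun h => ?_, ?_⟩⟩
    · exact (eq_here_or_face B q).resolve_right fun ⟨y, hy⟩ => h.2 rfl y hy
    · rintro rfl
      exact ⟨le_rfl, fun _ y => face_true_ne_here B y⟩
  | true =>
    induction B using Bat.ind with
    | nil =>
      refine ⟨.here _, fun q => ⟨fun _ => by cases q; rfl, ?_⟩⟩
      rintro rfl
      exact ⟨le_rfl, fun _ y => by cases y⟩
    | cons B L _ ih =>
      obtain ⟨p, hp⟩ := ih
      refine ⟨.inr B L p, fun q => ⟨fun h => ?_, ?_⟩⟩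
      · cases q with
        | here => exact absurd rfl (h.2 rfl (Pos.inl B L (.here B)))
        | inr _ _ q =>
          rw [(hp q).1 ⟨le_rfl, fun _ y hy => h.2 rfl (.inr B L y) ?_⟩]
          exact (face_inr _ _ _ _).trans (congrArg _ hy)
      · rintro rfl
        refine ⟨le_rfl, fun _ y hy => ?_⟩
        cases y with
        | inr _ _ y =>
          have := (face_inr B L false y).symm.trans hy
          exact ((hp p).2 rfl).2 rfl y (Pos.inr.inj this)
        | inl _ _ y => cases hy

theorem mem_bd_here (B : Bat) (q : Pos.{u} B 0) :
    q ∈ (pos.{u} B).bd false 0 0 ↔ q = .here B :=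
  ⟨fun h => (eq_here_or_face B q).resolve_right fun ⟨y, hy⟩ => h.2 rfl y hy, by
    rintro rfl
    exact ⟨le_rfl, fun _ y => face_true_ne_here B y⟩⟩

/-- A `0`-position other than `here` is a target, and targets are sent to targets, never to `here`.
-/
theorem map_here {P B : Bat} (f : pos.{u} P ⟶ pos.{u} B) {p : Pos.{u} P 0}
    (h : Glob.Hom.app f 0 p = .here B) : Glob.Hom.app f 0 (.here P) = .here B := by
  obtain rfl | ⟨q, rfl⟩ := eq_here_or_face P p
  · exact h
  · rw [Glob.app_face] at h
    exact absurd h (face_true_ne_here B _)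

/-- The inclusion of the positions of `br L`. -/
def inrHom (B : Bat) (L : List Bat) : pos.{u} (.br L) ⟶ pos.{u} (.br (B :: L)) :=
  Glob.homMk (fun _ p => .inr B L p) fun ε _ p => (face_inr B L ε p).symm

/-- The inclusion of the positions of the first branch. -/
def inlHom (B : Bat) (L : List Bat) : pos.{u} B ⟶ (pos.{u} (.br (B :: L))).shift :=
  Glob.homMk (fun _ p => .inl B L p) fun ε _ p => (face_inl B L ε p).symm

/-- Consecutive `0`-positions of `B` are the two faces of a `1`-position, whose image is a `2`-cell
of `X`; by globularity the faces of that cell are parallel. -/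
theorem face_shift_const (B : Bat) (ε : Bool) {X : Glob.{u}} (g : pos.{u} B ⟶ X.shift)
    (q : Pos.{u} B 0) :
    X.face ε (Glob.Hom.app g 0 q) = X.face ε (Glob.Hom.app g 0 (.here B)) := by
  induction B using Bat.ind with
  | nil => cases q; rfl
  | cons B L _ ih =>
    cases q with
    | here => rfl
    | inr _ _ q =>
      refine (ih (inrHom B L ≫ g) q).trans ?_
      have h : ∀ δ, Glob.Hom.app g 0 ((pos.{u} (.br (B :: L))).face δ (.inl B L (.here B))) =
          X.shift.face δ (Glob.Hom.app g 1 (.inl B L (.here B))) := fun δ => Glob.app_face g δ _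
      exact (congrArg (X.face ε) (h true)).trans
        ((X.face_face ε true false _).trans (congrArg (X.face ε) (h false)).symm)

section ConsDesc

variable {B : Bat} {L : List Bat} {X : Glob.{u}}

/-- Auxiliary: the underlying maps of `consDesc`. -/
def consFun (g : pos.{u} B ⟶ X.shift) (f : pos.{u} (.br L) ⟶ X) :
    ∀ n, Pos.{u} (.br (B :: L)) n → X.cell n
  | _, .here _ => X.face false (Glob.Hom.app g 0 (.here B))
  | _, .inr _ _ p => Glob.Hom.app f _ p
  | _, .inl _ _ q => Glob.Hom.app g _ q

/-- Morphisms out of the positions of `br (B :: L)`. -/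
def consDesc (g : pos.{u} B ⟶ X.shift) (f : pos.{u} (.br L) ⟶ X)
    (h : X.face true (Glob.Hom.app g 0 (.here B)) = Glob.Hom.app f 0 (.here (.br L))) :
    pos.{u} (.br (B :: L)) ⟶ X :=
  Glob.homMk (consFun g f) fun ε n x => by
    match n, x with
    | _, .inr _ _ p => exact (congrArg _ (face_inr B L ε p)).trans (Glob.app_face f ε p)
    | 0, .inl _ _ q =>
      cases ε with
      | false => exact (face_shift_const B false g q).symm
      | true => exact h.symm.trans (face_shift_const B true g q).symm
    | _ + 1, .inl _ _ q => exact (congrArg _ (face_inl B L ε q)).trans (Glob.app_face g ε q)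

variable (g : pos.{u} B ⟶ X.shift) (f : pos.{u} (.br L) ⟶ X)
  (h : X.face true (Glob.Hom.app g 0 (.here B)) = Glob.Hom.app f 0 (.here (.br L)))

theorem cons_hom_ext {f g : pos.{u} (.br (B :: L)) ⟶ X}
    (hl : ∀ n (q : Pos.{u} B n), Glob.Hom.app f (n + 1) (.inl B L q) =
      Glob.Hom.app g (n + 1) (.inl B L q))
    (hr : ∀ n (p : Pos.{u} (.br L) n), Glob.Hom.app f n (.inr B L p) =
      Glob.Hom.app g n (.inr B L p)) : f = g := by
  refine Glob.hom_ext fun n x => ?_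
  cases x with
  | here =>
    have h : ∀ k : pos.{u} (.br (B :: L)) ⟶ X, Glob.Hom.app k 0 (.here (.br (B :: L))) =
      X.face false (Glob.Hom.app k 1 (.inl B L (.here B))) := fun k =>
      Glob.app_face k false (Pos.inl B L (.here B) : Pos.{u} (.br (B :: L)) 1)
    rw [h, h, hl]
  | inr _ _ p => exact hr _ p
  | inl _ _ q => exact hl _ q

end ConsDesc

/-- The morphism given by a morphism on the first branch and one on the rest. -/
def consMap {B B' : Bat} {L L' : List Bat} (g : pos.{u} B ⟶ pos.{u} B')
    (f : pos.{u} (.br L) ⟶ pos.{u} (.br L'))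
    (h : Glob.Hom.app f 0 (.here (.br L)) = .here (.br L')) :
    pos.{u} (.br (B :: L)) ⟶ pos.{u} (.br (B' :: L')) :=
  consDesc (g ≫ inlHom B' L') (f ≫ inrHom B' L') (congrArg (Pos.inr B' L') h.symm)

section ConsMap

variable {B B' : Bat} {L L' : List Bat} (g : pos.{u} B ⟶ pos.{u} B')
    (f : pos.{u} (.br L) ⟶ pos.{u} (.br L'))
    (h : Glob.Hom.app f 0 (.here (.br L)) = .here (.br L'))

theorem consMap_inl {n : ℕ} (q : Pos.{u} B n) :
    Glob.Hom.app (consMap g f h) (n + 1) (.inl B L q) = .inl B' L' (Glob.Hom.app g n q) := rfl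

theorem consMap_inr {n : ℕ} (p : Pos.{u} (.br L) n) :
    Glob.Hom.app (consMap g f h) n (.inr B L p) = .inr B' L' (Glob.Hom.app f n p) := rfl

/-- Faces of positive dimension are computed within one branch. The first branch is shifted up by
one, hence the drop from `k + 1` to `k`; in dimension `0` no condition remains, since `0 < k + 1`.
-/
theorem isBd_consMap {ε : Bool} {k : ℕ} (hg : Glob.IsBd g ε k) (hf : Glob.IsBd f ε (k + 1)) :
    Glob.IsBd (consMap g f h) ε (k + 1) := by
  intro n y
  cases y with
  | here => exact ⟨fun _ => ⟨Nat.zero_le _, fun h => by omega⟩, fun _ => ⟨.here _, rfl⟩⟩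
  | @inl _ _ n q =>
    constructor
    · rintro ⟨x, hx⟩
      cases x with
      | inr _ _ x => cases hx
      | inl _ _ x =>
        rw [consMap_inl] at hx
        obtain ⟨h₁, h₂⟩ := (hg _ q).1 ⟨x, Pos.inl.inj hx⟩
        refine ⟨by omega, fun hn y hy => ?_⟩
        cases y with
        | inr _ _ y => rw [face_inr] at hy; cases hy
        | inl _ _ y =>
          rw [face_inl] at hy
          exact h₂ (by omega) y (Pos.inl.inj hy)
    · rintro ⟨h₁, h₂⟩
      obtain ⟨x, rfl⟩ := (hg _ q).2 ⟨by omega, fun hn y hy => h₂ (by omega) (.inl _ _ y) (by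
        rw [face_inl]; exact congrArg _ hy)⟩
      exact ⟨.inl _ _ x, rfl⟩
  | inr _ _ p =>
    constructor
    · rintro ⟨x, hx⟩
      cases x with
      | here => cases hx
      | inl _ _ x => cases hx
      | inr _ _ x =>
        rw [consMap_inr] at hx
        obtain ⟨h₁, h₂⟩ := (hf _ p).1 ⟨x, Pos.inr.inj hx⟩
        refine ⟨h₁, fun hn y hy => ?_⟩
        subst hn
        cases y with
        | inr _ _ y =>
          rw [face_inr] at hy
          exact h₂ rfl y (Pos.inr.inj hy)
        | inl _ _ y => rw [face_inl] at hy; cases hy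
    · rintro ⟨h₁, h₂⟩
      obtain ⟨x, rfl⟩ := (hf _ p).2 ⟨h₁, fun hn y hy => h₂ hn (.inr _ _ y) (by
        rw [face_inr]; exact congrArg _ hy)⟩
      exact ⟨.inr _ _ x, rfl⟩

end ConsMap

/-- The morphism from the one-point tree given by a `0`-cell. -/
def pointMap {X : Glob.{u}} (x : X.cell 0) : pos.{u} (.br []) ⟶ X :=
  Glob.homMk (fun n p => match n, p with | _, .here _ => x) fun _ n p => by cases p

theorem isBd_pointMap {B : Bat} {p : Pos.{u} B 0} {ε : Bool} (hp : p ∈ (pos.{u} B).bd ε 0 0) :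
    Glob.IsBd (pointMap (X := pos.{u} B) p) ε 0 := by
  intro n y
  constructor
  · rintro ⟨x, rfl⟩
    cases x
    exact hp
  · intro hy
    obtain rfl : n = 0 := Nat.le_zero.1 hy.1
    obtain ⟨q, hq⟩ := exists_bd_zero.{u} B ε
    exact ⟨.here _, ((hq p).1 hp).trans ((hq y).1 hy).symm⟩

theorem isBd_id {B : Bat} (ε : Bool) {k : ℕ} (h : B.dim ≤ k) : Glob.IsBd (𝟙 (pos.{u} B)) ε k :=
  fun _ y => ⟨fun _ => ⟨(le_dim y).trans h, fun hn z => by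
    have := le_dim z
    omega⟩, fun _ => ⟨y, rfl⟩⟩

/-- Every tree has boundaries, which are trees. -/
theorem exists_isBd (B : Bat) (ε : Bool) (k : ℕ) :
    ∃ (P : Bat) (i : pos.{u} P ⟶ pos.{u} B), Glob.IsBd i ε k := by
  induction B using Bat.ind generalizing k with
  | nil => exact ⟨_, _, isBd_id ε (by rw [Bat.dim_nil]; exact Nat.zero_le k)⟩
  | cons B L hB hL =>
    cases k with
    | zero =>
      obtain ⟨p, hp⟩ := exists_bd_zero.{u} (.br (B :: L)) ε
      exact ⟨_, _, isBd_pointMap ((hp p).2 rfl)⟩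
    | succ k =>
      obtain ⟨P, i, hi⟩ := hB k
      obtain ⟨⟨M⟩, j, hj⟩ := hL (k + 1)
      obtain ⟨x, hx⟩ := (hj 0 (.here _)).2 ⟨Nat.zero_le _, fun h => by omega⟩
      exact ⟨_, _, isBd_consMap i j (map_here j hx) hi hj⟩

theorem IsBd.dim_le {P B : Bat} {i : pos.{u} P ⟶ pos.{u} B} {ε : Bool} {k : ℕ}
    (h : Glob.IsBd i ε k) : P.dim ≤ k := by
  obtain ⟨x⟩ := nonempty_dim.{u} P
  exact ((h _ _).1 ⟨x, rfl⟩).1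

/-- `IsBd` prescribes the image, and the image determines tree and morphism. This allows an
arbitrary boundary to be replaced by an explicitly constructed one. -/
theorem IsBd.unique {P Q B : Bat} {i : pos.{u} P ⟶ pos.{u} B} {j : pos.{u} Q ⟶ pos.{u} B}
    {ε : Bool} {k : ℕ} (hi : Glob.IsBd i ε k) (hj : Glob.IsBd j ε k) :
    (⟨P, i⟩ : Σ P : Bat, (pos.{u} P ⟶ pos.{u} B)) = ⟨Q, j⟩ :=
  eq_of_image_eq i j fun n y => (hi n y).trans (hj n y).symm

/-- A position outside the `δ`-boundary is the opposite face of some `z`. Replacing it by the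
`δ`-face of `z` keeps all lower faces and moves it in one direction of the linear order, so the
process stops. -/
theorem face_mem_bd (B : Bat) (δ ε : Bool) {n k : ℕ} (hk : n < k) (x : Pos.{u} B (n + 1)) :
    ∃ y ∈ (pos.{u} B).bd δ k (n + 1), (pos.{u} B).face ε y = (pos.{u} B).face ε x := by
  obtain hk | rfl := lt_or_eq_of_le (Nat.succ_le_of_lt hk)
  · exact ⟨x, ⟨hk.le, fun h => by omega⟩, rfl⟩
  have key : ∀ (w : Pos.{u} B (n + 1) → ℕ), (∀ z : Pos.{u} B (n + 2),
      w ((pos.{u} B).face δ z) < w ((pos.{u} B).face (!δ) z)) →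
      ∃ y ∈ (pos.{u} B).bd δ (n + 1) (n + 1), (pos.{u} B).face ε y = (pos.{u} B).face ε x := by
    intro w hw
    induction hm : w x using Nat.strong_induction_on generalizing x with
    | _ m ih =>
      by_cases hx : x ∈ (pos.{u} B).bd δ (n + 1) (n + 1)
      · exact ⟨x, hx, rfl⟩
      · obtain ⟨z, rfl⟩ : ∃ z : Pos.{u} B (n + 2), (pos.{u} B).face (!δ) z = x := by
          by_contra! h
          exact hx ⟨le_rfl, fun _ => h⟩
        obtain ⟨y, hy, hyx⟩ := ih _ (hm ▸ hw z) _ rfl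
        exact ⟨y, hy, hyx.trans (Glob.face_face _ _ _ _ _)⟩
  cases δ with
  | false => exact key idx fun z => (idx_src z).trans (idx_tgt z)
  | true =>
    -- For targets the walk goes upwards, so the measure is the distance to the end of the order;
    -- `idx_lt` keeps the truncated subtraction strict.
    refine key (fun p => B.dims.length - idx p) fun z => ?_
    have h₁ := (idx_src z).trans (idx_tgt z)
    have h₂ := idx_lt z.tgt
    show B.dims.length - idx z.tgt < B.dims.length - idx z.src
    omega

/-- Boundaries of lower dimension of a boundary. -/
theorem isBd_comp_iff {S P U : Bat} {p : pos.{u} S ⟶ pos.{u} P} {i : pos.{u} P ⟶ pos.{u} U}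
    {δ : Bool} {k : ℕ} (hi : Glob.IsBd i δ k) (ε : Bool) {n : ℕ} (hn : n < k) :
    Glob.IsBd (p ≫ i) ε n ↔ Glob.IsBd p ε n := by
  have key : ∀ m (x : Pos.{u} P m),
      Glob.Hom.app i m x ∈ (pos.{u} U).bd ε n m ↔ x ∈ (pos.{u} P).bd ε n m := by
    refine fun m x => and_congr_right fun hm => forall_congr' fun h => ?_
    subst h
    constructor
    · exact fun h y hy => h (Glob.Hom.app i _ y) (by rw [← Glob.app_face, hy])
    · intro h y hy
      -- A position of `U` witnessing failure need not lie in `P`; one in the `δ`-boundary with the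
      -- same face does.
      obtain ⟨z, hz, hzy⟩ := face_mem_bd U δ (!ε) hn y
      obtain ⟨z, rfl⟩ := (hi _ _).2 hz
      refine h z (inj i _ ?_)
      rw [Glob.app_face, hzy, hy]
  constructor
  · intro h m y
    rw [← key, ← h]
    exact ⟨fun ⟨x, hx⟩ => ⟨x, congrArg _ hx⟩, fun ⟨x, hx⟩ => ⟨x, inj i _ hx⟩⟩
  · intro h m y
    constructor
    · rintro ⟨x, rfl⟩
      exact (key _ _).2 ((h _ _).1 ⟨x, rfl⟩)
    · intro hy
      obtain ⟨x, rfl⟩ := (hi m y).2 ⟨hy.1.trans hn.le, fun h => by have := hy.1; omega⟩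
      obtain ⟨z, rfl⟩ := (h _ _).2 ((key _ _).1 hy)
      exact ⟨z, rfl⟩

end Pos

/-! ### Disks -/

/-- The iterated suspension of a tree. -/
def susp : ℕ → Bat → Bat
  | 0, B => B
  | k + 1, B => .br [susp k B]

theorem susp_br (k : ℕ) (B : Bat) : susp k (.br [B]) = susp (k + 1) B := by
  induction k with
  | zero => rfl
  | succ k ih => rw [susp, ih]; rfl

/-- The tree with a unique position of dimension `n` and two in each lower dimension. -/
def disc (n : ℕ) : Bat := susp n (.br [])

namespace disc

theorem dim_eq (n : ℕ) : (disc n).dim = n := by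
  induction n with
  | zero => exact Bat.dim_nil
  | succ n ih =>
    rw [disc, susp, Bat.dim_cons, Bat.dim_nil]
    rw [disc] at ih
    omega

/-- The position of dimension `n` of the `n`-disk. -/
def top : ∀ n, Pos.{u} (disc n) n
  | 0 => .here _
  | n + 1 => .inl _ _ (top n)

theorem eq_top : ∀ {n : ℕ} (p : Pos.{u} (disc n) n), p = top n
  | 0, p => by cases p; rfl
  | n + 1, p => by
    cases p with
    | inr _ _ p => cases p
    | inl _ _ p => exact congrArg (Pos.inl (disc n) []) (eq_top p)

/-- The morphism from a disk given by a cell. -/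
def map : ∀ (n : ℕ) (X : Glob.{u}), X.cell n → (pos.{u} (disc n) ⟶ X)
  | 0, _, x => Pos.pointMap x
  | n + 1, X, x => Pos.consDesc (map n X.shift x)
      (Pos.pointMap (X.face true (Glob.Hom.app (map n X.shift x) 0 (.here (disc n))))) rfl

theorem map_top : ∀ (n : ℕ) (X : Glob.{u}) (x : X.cell n), Glob.Hom.app (map n X x) n (top n) = x
  | 0, _, _ => rfl
  | n + 1, X, x => map_top n X.shift x

/-- All other positions are iterated faces of the top one; together with `map`, disks represent
cells. The recursion restricts to the unique branch, viewed in `X.shift`. -/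
theorem hom_ext : ∀ {n : ℕ} {X : Glob.{u}} {f g : pos.{u} (disc n) ⟶ X},
    Glob.Hom.app f n (top n) = Glob.Hom.app g n (top n) → f = g
  | 0, _, f, g, h => Glob.hom_ext fun m p => by cases p; exact h
  | n + 1, X, f, g, h => by
    let sh : (pos.{u} (disc (n + 1)) ⟶ X) → (pos.{u} (disc n) ⟶ X.shift) := fun k =>
      Glob.homMk (fun m q => Glob.Hom.app k (m + 1) (Pos.inl (disc n) [] q)) fun ε m q =>
        (congrArg _ (Pos.face_inl (disc n) [] ε q).symm).trans (Glob.app_face k ε _)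
    have e : sh f = sh g := hom_ext h
    have el : ∀ m (q : Pos.{u} (disc n) m), Glob.Hom.app f (m + 1) (Pos.inl (disc n) [] q) =
        Glob.Hom.app g (m + 1) (Pos.inl (disc n) [] q) := fun m q =>
      congrArg (fun k : pos.{u} (disc n) ⟶ X.shift => Glob.Hom.app k m q) e
    refine Pos.cons_hom_ext (B := disc n) (L := []) el fun m p => ?_
    cases p
    have h : ∀ k : pos.{u} (disc (n + 1)) ⟶ X,
      Glob.Hom.app k 0 (Pos.inr (disc n) [] (.here (.br []))) =
        X.face true (Glob.Hom.app k 1 (Pos.inl (disc n) [] (.here (disc n)))) :=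
      fun k => Glob.app_face k true (Pos.inl (disc n) [] (.here (disc n)) : Pos.{u} (disc (n + 1)) 1)
    rw [h, h, el]

theorem map_comp {n : ℕ} {X Y : Glob.{u}} (x : X.cell n) (f : X ⟶ Y) :
    map n X x ≫ f = map n Y (Glob.Hom.app f n x) :=
  hom_ext (by rw [Glob.comp_app, map_top, map_top])

/-- The inclusion of the `n`-disk as a boundary of the `(n+1)`-disk. -/
def incl (ε : Bool) (n : ℕ) : pos.{u} (disc n) ⟶ pos.{u} (disc (n + 1)) :=
  map n _ ((pos.{u} (disc (n + 1))).face ε (top (n + 1)))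

theorem incl_comp {ε : Bool} {n : ℕ} {X : Glob.{u}} (x : X.cell (n + 1)) :
    incl ε n ≫ map (n + 1) X x = map n X (X.face ε x) := by
  rw [incl, map_comp, Glob.app_face, map_top]

/-- Each inclusion is the suspension of the preceding one, so `Pos.isBd_consMap` applies; the second
component is the identity of a point. -/
theorem isBd_incl (ε : Bool) : ∀ n, Glob.IsBd (incl.{u} ε n) ε n
  | 0 => by
    refine Pos.isBd_pointMap ⟨le_rfl, fun _ y hy => ?_⟩
    rw [eq_top y] at hy
    cases ε <;> cases hy
  | n + 1 => by
    have h : incl.{u} ε (n + 1) = Pos.consMap (B := disc n) (B' := disc (n + 1)) (L := []) (L' := [])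
        (incl ε n) (𝟙 _) rfl := by
      refine hom_ext ?_
      rw [incl, map_top]
      refine (Pos.face_inl _ _ _ _).trans ?_
      refine Eq.trans ?_ (Pos.consMap_inl _ _ _ _).symm
      rw [incl, map_top]
      rfl
    rw [h]
    exact Pos.isBd_consMap _ _ _ (isBd_incl ε n) (Pos.isBd_id ε (by rw [Bat.dim_nil]; omega))

end disc

/-! ### Pasting squares -/

/-- The tree `W` is obtained by pasting `U` and `V` along a common boundary `P` of dimension
`k`. -/
structure PasteSq (ε : Bool) (k : ℕ) {P U V W : Bat} (i : pos.{u} P ⟶ pos.{u} U)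
    (j : pos.{u} P ⟶ pos.{u} V) (a : pos.{u} U ⟶ pos.{u} W) (b : pos.{u} V ⟶ pos.{u} W) :
    Prop where
  left : Glob.IsBd i ε k
  right : Glob.IsBd j (!ε) k
  comm : i ≫ a = j ≫ b
  surj : ∀ n (w : Pos.{u} W n), (∃ x, Glob.Hom.app a n x = w) ∨ ∃ y, Glob.Hom.app b n y = w
  inter : ∀ n (x : Pos.{u} U n) (y : Pos.{u} V n), Glob.Hom.app a n x = Glob.Hom.app b n y →
    ∃ p, Glob.Hom.app i n p = x ∧ Glob.Hom.app j n p = y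

namespace PasteSq

section

variable {ε : Bool} {k : ℕ} {P U V W : Bat} {i : pos.{u} P ⟶ pos.{u} U} {j : pos.{u} P ⟶ pos.{u} V}
  {a : pos.{u} U ⟶ pos.{u} W} {b : pos.{u} V ⟶ pos.{u} W}

theorem swap (S : PasteSq ε k i j a b) : PasteSq (!ε) k j i b a where
  left := S.right
  right := by simpa using S.left
  comm := S.comm.symm
  surj n w := (S.surj n w).symm
  inter n x y h := by
    obtain ⟨p, hp, hp'⟩ := S.inter n y x h.symm
    exact ⟨p, hp', hp⟩

theorem comm_app (S : PasteSq ε k i j a b) {n : ℕ} (p : Pos.{u} P n) :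
    Glob.Hom.app a n (Glob.Hom.app i n p) = Glob.Hom.app b n (Glob.Hom.app j n p) :=
  congrArg (fun f : pos.{u} P ⟶ pos.{u} W => Glob.Hom.app f n p) S.comm

/-- A pasting square is a pushout. -/
theorem exists_desc (S : PasteSq ε k i j a b) {X : Glob.{u}} (f : pos.{u} U ⟶ X)
    (g : pos.{u} V ⟶ X) (h : i ≫ f = j ≫ g) : ∃ m : pos.{u} W ⟶ X, a ≫ m = f ∧ b ≫ m = g := by
  have h' : ∀ n p, Glob.Hom.app f n (Glob.Hom.app i n p) = Glob.Hom.app g n (Glob.Hom.app j n p) :=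
    fun n p => congrArg (fun f : pos.{u} P ⟶ X => Glob.Hom.app f n p) h
  -- The value at `w` is read off any preimage: `a` and `b` are injective, and a cell in both images
  -- comes from `P`, where `f` and `g` agree.
  have key : ∀ n (w : Pos.{u} W n), ∃ z : X.cell n, (∀ x, Glob.Hom.app a n x = w →
      Glob.Hom.app f n x = z) ∧ ∀ y, Glob.Hom.app b n y = w → Glob.Hom.app g n y = z := by
    intro n w
    obtain ⟨x, rfl⟩ | ⟨y, rfl⟩ := S.surj n w
    · refine ⟨Glob.Hom.app f n x, fun x' hx => by rw [Pos.inj a n hx], fun y hy => ?_⟩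
      obtain ⟨p, rfl, rfl⟩ := S.inter n x y hy.symm
      exact (h' n p).symm
    · refine ⟨Glob.Hom.app g n y, fun x hx => ?_, fun y' hy => by rw [Pos.inj b n hy]⟩
      obtain ⟨p, rfl, rfl⟩ := S.inter n x y hx
      exact h' n p
  choose m hm using key
  refine ⟨Glob.homMk m fun δ n w => ?_, Glob.hom_ext fun n x => ((hm n _).1 x rfl).symm,
    Glob.hom_ext fun n y => ((hm n _).2 y rfl).symm⟩
  obtain ⟨x, rfl⟩ | ⟨y, rfl⟩ := S.surj _ w
  · rw [← (hm _ _).1 x rfl, ← Glob.app_face, ← Glob.app_face]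
    exact ((hm _ _).1 _ rfl).symm
  · rw [← (hm _ _).2 y rfl, ← Glob.app_face, ← Glob.app_face]
    exact ((hm _ _).2 _ rfl).symm

theorem app_ext (S : PasteSq ε k i j a b) {p : ∀ n, Pos.{u} W n → Prop}
    (ha : ∀ n x, p n (Glob.Hom.app a n x)) (hb : ∀ n y, p n (Glob.Hom.app b n y)) (n : ℕ)
    (w : Pos.{u} W n) : p n w := by
  obtain ⟨x, rfl⟩ | ⟨y, rfl⟩ := S.surj n w
  exacts [ha n x, hb n y]

/-- The degenerate pasting, where the first piece is the common boundary itself; it starts the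
inductions constructing pasting squares. -/
theorem of_dim_le (j : pos.{u} P ⟶ pos.{u} V) (hj : Glob.IsBd j (!ε) k) (hP : P.dim ≤ k) :
    PasteSq ε k (𝟙 _) j j (𝟙 _) where
  left := Pos.isBd_id ε hP
  right := hj
  comm := by rw [Category.id_comp, Category.comp_id]
  surj _ w := .inr ⟨w, rfl⟩
  inter _ x _ h := ⟨x, rfl, h⟩

theorem mem_bd_of_mem_left (a : pos.{u} U ⟶ pos.{u} W) {δ : Bool} {n m : ℕ} {x : Pos.{u} U m}
    (h : Glob.Hom.app a m x ∈ (pos.{u} W).bd δ n m) : x ∈ (pos.{u} U).bd δ n m := by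
  refine ⟨h.1, fun hm y hy => ?_⟩
  exact h.2 hm (Glob.Hom.app a _ y) (by rw [← Glob.app_face, hy])

/-- Below dimension `k` both pieces have the boundaries of `P`, because a boundary of a boundary is
a boundary of the whole. The pasting then adds nothing to them. -/
theorem isBd_lt (S : PasteSq ε k i j a b) {δ : Bool} {n : ℕ} (hn : n < k) {R : Bat}
    {r : pos.{u} R ⟶ pos.{u} U} (hr : Glob.IsBd r δ n) : Glob.IsBd (r ≫ a) δ n := by
  obtain ⟨R', p, hp⟩ := Pos.exists_isBd.{u} P δ n
  have hi := (Pos.isBd_comp_iff S.left δ hn).2 hp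
  have hj := (Pos.isBd_comp_iff S.right δ hn).2 hp
  obtain ⟨rfl, h⟩ := Sigma.mk.inj_iff.1 (Pos.IsBd.unique hr hi)
  obtain rfl := eq_of_heq h
  intro m w
  constructor
  · rintro ⟨s, rfl⟩
    refine ⟨((hp _ _).1 ⟨s, rfl⟩).1, ?_⟩
    rintro rfl z hz
    obtain ⟨x, rfl⟩ | ⟨y, rfl⟩ := S.surj _ z
    · rw [← Glob.app_face] at hz
      exact ((hr _ _).1 ⟨s, rfl⟩).2 rfl x (Pos.inj a _ hz)
    · rw [← Glob.app_face] at hz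
      exact ((hj _ _).1 ⟨s, rfl⟩).2 rfl y (Pos.inj b _ (hz.trans (S.comm_app _)))
  · intro hw
    obtain ⟨x, rfl⟩ | ⟨y, rfl⟩ := S.surj _ w
    · obtain ⟨s, rfl⟩ := (hr _ _).2 (mem_bd_of_mem_left a hw)
      exact ⟨s, rfl⟩
    · obtain ⟨s, rfl⟩ := (hj _ _).2 (mem_bd_of_mem_left b hw)
      exact ⟨s, S.comm_app _⟩

/-- In dimension `k` the free side of `U` stays on the boundary. The `(!ε)`-boundary of `V` is `P`,
so a boundary position coming from `V` also comes from `U`. -/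
theorem isBd_eq (S : PasteSq ε k i j a b) {R : Bat} {r : pos.{u} R ⟶ pos.{u} U}
    (hr : Glob.IsBd r (!ε) k) : Glob.IsBd (r ≫ a) (!ε) k := by
  intro m w
  constructor
  · rintro ⟨s, rfl⟩
    refine ⟨((hr _ _).1 ⟨s, rfl⟩).1, ?_⟩
    rintro rfl z hz
    obtain ⟨x, rfl⟩ | ⟨y, rfl⟩ := S.surj _ z
    · rw [← Glob.app_face] at hz
      exact ((hr _ _).1 ⟨s, rfl⟩).2 rfl x (Pos.inj a _ hz)
    · rw [← Glob.app_face] at hz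
      obtain ⟨d, -, hd⟩ := S.inter _ _ _ hz.symm
      exact ((S.right _ _).1 ⟨d, rfl⟩).2 rfl y hd.symm
  · intro hw
    obtain ⟨x, rfl⟩ | ⟨y, rfl⟩ := S.surj _ w
    · obtain ⟨s, rfl⟩ := (hr _ _).2 (mem_bd_of_mem_left a hw)
      exact ⟨s, rfl⟩
    · obtain ⟨d, rfl⟩ := (S.right _ _).2 (mem_bd_of_mem_left b hw)
      rw [← S.comm_app] at hw ⊢
      obtain ⟨s, hs⟩ := (hr _ _).2 (mem_bd_of_mem_left a hw)
      exact ⟨s, congrArg _ hs⟩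

theorem app_mem_bd (S : PasteSq ε k i j a b) {δ : Bool} {n m : ℕ} (hn : k < n) {x : Pos.{u} U m}
    (hx : x ∈ (pos.{u} U).bd δ n m) : Glob.Hom.app a m x ∈ (pos.{u} W).bd δ n m := by
  refine ⟨hx.1, ?_⟩
  rintro rfl z hz
  obtain ⟨z, rfl⟩ | ⟨y, rfl⟩ := S.surj _ z
  · rw [← Glob.app_face] at hz
    exact hx.2 rfl z (Pos.inj a _ hz)
  · rw [← Glob.app_face] at hz
    obtain ⟨d, hd, -⟩ := S.inter _ _ _ hz.symm
    -- A position shared by both pieces comes from `P`, so its dimension is at most `k`, contrary to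
    -- `k < n`.
    exact absurd ((S.left _ _).1 ⟨d, rfl⟩).1 (by omega)

/-- Boundaries of dimension greater than `k` of a pasting along a boundary of dimension `k`. -/
theorem exists_boundary (S : PasteSq ε k i j a b) {δ : Bool} {n : ℕ} (hn : k < n) {R R₁ R₂ : Bat}
    {r : pos.{u} R ⟶ pos.{u} W} {r₁ : pos.{u} R₁ ⟶ pos.{u} U} {r₂ : pos.{u} R₂ ⟶ pos.{u} V}
    (hr : Glob.IsBd r δ n) (hr₁ : Glob.IsBd r₁ δ n) (hr₂ : Glob.IsBd r₂ δ n) :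
    ∃ (i' : pos.{u} P ⟶ pos.{u} R₁) (j' : pos.{u} P ⟶ pos.{u} R₂) (a' : pos.{u} R₁ ⟶ pos.{u} R)
      (b' : pos.{u} R₂ ⟶ pos.{u} R), i' ≫ r₁ = i ∧ j' ≫ r₂ = j ∧ a' ≫ r = r₁ ≫ a ∧ b' ≫ r = r₂ ≫ b ∧
        PasteSq ε k i' j' a' b' := by
  obtain ⟨i', hi'⟩ := Glob.exists_lift i r₁ (Pos.inj r₁) fun m x => by
    have := ((S.left m _).1 ⟨x, rfl⟩).1
    exact (hr₁ m _).2 ⟨by omega, by omega⟩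
  obtain ⟨j', hj'⟩ := Glob.exists_lift j r₂ (Pos.inj r₂) fun m x => by
    have := ((S.right m _).1 ⟨x, rfl⟩).1
    exact (hr₂ m _).2 ⟨by omega, by omega⟩
  obtain ⟨a', ha'⟩ := Glob.exists_lift (r₁ ≫ a) r (Pos.inj r) fun m x =>
    (hr m _).2 (S.app_mem_bd hn ((hr₁ _ _).1 ⟨x, rfl⟩))
  obtain ⟨b', hb'⟩ := Glob.exists_lift (r₂ ≫ b) r (Pos.inj r) fun m x =>
    (hr m _).2 (S.swap.app_mem_bd hn ((hr₂ _ _).1 ⟨x, rfl⟩))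
  have hai : ∀ m x, Glob.Hom.app r m (Glob.Hom.app a' m x) =
      Glob.Hom.app a m (Glob.Hom.app r₁ m x) := fun m x =>
    congrArg (fun f : pos.{u} R₁ ⟶ pos.{u} W => Glob.Hom.app f m x) ha'
  have hbi : ∀ m x, Glob.Hom.app r m (Glob.Hom.app b' m x) =
      Glob.Hom.app b m (Glob.Hom.app r₂ m x) := fun m x =>
    congrArg (fun f : pos.{u} R₂ ⟶ pos.{u} W => Glob.Hom.app f m x) hb'
  refine ⟨i', j', a', b', hi', hj', ha', hb', ?_, ?_, ?_, ?_, ?_⟩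
  · exact (Pos.isBd_comp_iff hr₁ ε hn).1 (by rw [hi']; exact S.left)
  · exact (Pos.isBd_comp_iff hr₂ (!ε) hn).1 (by rw [hj']; exact S.right)
  · refine Glob.Inj.cancel (Pos.inj r) ?_
    rw [Category.assoc, Category.assoc, ha', hb', ← Category.assoc, ← Category.assoc, hi', hj',
      S.comm]
  · intro m w
    have hw := (hr m _).1 ⟨w, rfl⟩
    obtain ⟨x, hx⟩ | ⟨y, hy⟩ := S.surj m (Glob.Hom.app r m w)
    · rw [← hx] at hw
      obtain ⟨x', rfl⟩ := (hr₁ _ _).2 (mem_bd_of_mem_left a hw)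
      exact .inl ⟨x', Pos.inj r _ ((hai m x').trans hx)⟩
    · rw [← hy] at hw
      obtain ⟨y', rfl⟩ := (hr₂ _ _).2 (mem_bd_of_mem_left b hw)
      exact .inr ⟨y', Pos.inj r _ ((hbi m y').trans hy)⟩
  · intro m x y hxy
    obtain ⟨p, hp, hp'⟩ := S.inter m (Glob.Hom.app r₁ m x) (Glob.Hom.app r₂ m y) (by
      rw [← hai, hxy, hbi])
    refine ⟨p, Pos.inj r₁ _ ?_, Pos.inj r₂ _ ?_⟩
    · rw [← hp, ← hi', Glob.comp_app]
    · rw [← hp', ← hj', Glob.comp_app]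

end

/-- For `k = 0`, `here` is the source boundary, which a pasting inherits from its first piece. For
positive `k` all `0`-positions of `V` already come from `P`. Such facts are the compatibility that
`Pos.consMap` requires. -/
theorem left_map_here {k : ℕ} {P U V W : Bat} {i : pos.{u} P ⟶ pos.{u} U}
    {j : pos.{u} P ⟶ pos.{u} V} {a : pos.{u} U ⟶ pos.{u} W} {b : pos.{u} V ⟶ pos.{u} W}
    (S : PasteSq true k i j a b) : Glob.Hom.app a 0 (.here U) = .here W := by
  cases k with
  | zero =>
    have h := S.isBd_eq (Pos.isBd_pointMap ((Pos.mem_bd_here U _).2 rfl))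
    exact (Pos.mem_bd_here W _).1 ((h 0 _).1 ⟨.here _, rfl⟩)
  | succ k =>
    obtain ⟨x, hx⟩ | ⟨y, hy⟩ := S.surj 0 (.here W)
    · exact Pos.map_here a hx
    · obtain ⟨p, rfl⟩ := (S.right 0 y).2 ⟨Nat.zero_le _, fun h => by omega⟩
      exact Pos.map_here a ((S.comm_app p).trans hy)

theorem isBd_map_here {P U : Bat} {i : pos.{u} P ⟶ pos.{u} U} {ε : Bool} {k : ℕ}
    (h : Glob.IsBd i ε (k + 1)) : Glob.Hom.app i 0 (.here P) = .here U := by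
  obtain ⟨x, hx⟩ := (h 0 (.here U)).2 ⟨Nat.zero_le _, fun h => by omega⟩
  exact Pos.map_here i hx

theorem right_map_here {ε : Bool} {k : ℕ} {P U V W : Bat} {i : pos.{u} P ⟶ pos.{u} U}
    {j : pos.{u} P ⟶ pos.{u} V} {a : pos.{u} U ⟶ pos.{u} W} {b : pos.{u} V ⟶ pos.{u} W}
    (S : PasteSq ε (k + 1) i j a b) : Glob.Hom.app b 0 (.here V) = .here W := by
  obtain ⟨x, hx⟩ | ⟨y, hy⟩ := S.surj 0 (.here W)
  · obtain ⟨p, rfl⟩ := (S.left 0 x).2 ⟨Nat.zero_le _, fun h => by omega⟩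
    exact Pos.map_here b ((S.comm_app p).symm.trans hx)
  · exact Pos.map_here b hy

theorem consMap {k : ℕ} {P U V W : Bat} {i : pos.{u} P ⟶ pos.{u} U}
    {j : pos.{u} P ⟶ pos.{u} V} {a : pos.{u} U ⟶ pos.{u} W} {b : pos.{u} V ⟶ pos.{u} W}
    (S : PasteSq true k i j a b) {P' U' V' W' : List Bat} {i' : pos.{u} (.br P') ⟶ pos.{u} (.br U')}
    {j' : pos.{u} (.br P') ⟶ pos.{u} (.br V')} {a' : pos.{u} (.br U') ⟶ pos.{u} (.br W')}
    {b' : pos.{u} (.br V') ⟶ pos.{u} (.br W')} (S' : PasteSq true (k + 1) i' j' a' b') :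
    PasteSq true (k + 1) (Pos.consMap i i' (isBd_map_here S'.left))
      (Pos.consMap j j' (isBd_map_here S'.right)) (Pos.consMap a a' S'.left_map_here)
      (Pos.consMap b b' S'.right_map_here) where
  left := Pos.isBd_consMap _ _ _ S.left S'.left
  right := Pos.isBd_consMap _ _ _ S.right S'.right
  comm := Pos.cons_hom_ext (fun n q => congrArg (Pos.inl W W') (S.comm_app q))
    (fun n q => congrArg (Pos.inr W W') (S'.comm_app q))
  surj n w := by
    cases w with
    | here => exact .inl ⟨.here _, rfl⟩
    | inl _ _ w =>
      refine (S.surj _ w).imp ?_ ?_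
      · rintro ⟨x, rfl⟩
        exact ⟨.inl _ _ x, rfl⟩
      · rintro ⟨x, rfl⟩
        exact ⟨.inl _ _ x, rfl⟩
    | inr _ _ w =>
      refine (S'.surj _ w).imp ?_ ?_
      · rintro ⟨x, rfl⟩
        exact ⟨.inr _ _ x, rfl⟩
      · rintro ⟨x, rfl⟩
        exact ⟨.inr _ _ x, rfl⟩
  inter n x y h := by
    cases x with
    | here =>
      cases y with
      | here => exact ⟨.here _, rfl, rfl⟩
      | inr _ _ y => cases h
    | inl _ _ x =>
      cases y with
      | inr _ _ y => cases h
      | inl _ _ y =>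
        obtain ⟨p, hp, hp'⟩ := S.inter _ x y (Pos.inl.inj h)
        exact ⟨.inl _ _ p, congrArg (Pos.inl U U') hp, congrArg (Pos.inl V V') hp'⟩
    | inr _ _ x =>
      cases y with
      | here => cases h
      | inl _ _ y => cases h
      | inr _ _ y =>
        obtain ⟨p, hp, hp'⟩ := S'.inter _ x y (Pos.inr.inj h)
        exact ⟨.inr _ _ p, congrArg (Pos.inr U U') hp, congrArg (Pos.inr V V') hp'⟩

/-- The glueing takes place at the last `0`-position of `U`, which is unaffected by a new branch at
the front. -/
theorem inr {P V : Bat} {U W : List Bat} {i : pos.{u} P ⟶ pos.{u} (.br U)}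
    {j : pos.{u} P ⟶ pos.{u} V} {a : pos.{u} (.br U) ⟶ pos.{u} (.br W)}
    {b : pos.{u} V ⟶ pos.{u} (.br W)} (S : PasteSq true 0 i j a b) (B : Bat) :
    PasteSq true 0 (i ≫ Pos.inrHom B U) j (Pos.consMap (𝟙 (pos.{u} B)) a S.left_map_here)
      (b ≫ Pos.inrHom B W) where
  left := by
    intro n y
    constructor
    · rintro ⟨x, rfl⟩
      obtain ⟨h₀, h⟩ := (S.left n _).1 ⟨x, rfl⟩
      refine ⟨h₀, ?_⟩
      rintro rfl y hy
      cases y with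
      | inr _ _ y =>
        exact h rfl y (Pos.inr.inj ((Pos.face_inr B U _ y).symm.trans hy))
      | inl _ _ y => cases hy
    · intro hy
      obtain rfl : n = 0 := Nat.le_zero.1 hy.1
      cases y with
      | here => exact absurd rfl (hy.2 rfl (Pos.inl B U (.here B)))
      | inr _ _ y =>
        obtain ⟨x, rfl⟩ := (S.left 0 y).2 ⟨le_rfl, fun _ z hz => hy.2 rfl (.inr B U z)
          ((Pos.face_inr _ _ _ _).trans (congrArg _ hz))⟩
        exact ⟨x, rfl⟩
  right := S.right
  comm := Glob.hom_ext fun n p => congrArg (Pos.inr B W) (S.comm_app p)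
  surj n w := by
    cases w with
    | here => exact .inl ⟨.here _, rfl⟩
    | inl _ _ w => exact .inl ⟨.inl _ _ w, rfl⟩
    | inr _ _ w =>
      refine (S.surj _ w).imp ?_ ?_
      · rintro ⟨x, rfl⟩
        exact ⟨.inr _ _ x, rfl⟩
      · rintro ⟨x, rfl⟩
        exact ⟨x, rfl⟩
  inter n x y h := by
    cases x with
    | here => cases h
    | inl _ _ x => cases h
    | inr _ _ x =>
      obtain ⟨p, hp, hp'⟩ := S.inter _ x y (Pos.inr.inj h)
      exact ⟨p, congrArg (Pos.inr B U) hp, hp'⟩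

end PasteSq

theorem Pos.isBd_nil {P : Bat} {i : pos.{u} P ⟶ pos.{u} (.br [])} {ε : Bool} {k : ℕ}
    (hi : Glob.IsBd i ε k) :
    (⟨P, i⟩ : Σ P : Bat, (pos.{u} P ⟶ pos.{u} (.br []))) = ⟨.br [], 𝟙 _⟩ :=
  IsBd.unique hi (isBd_id ε (by rw [Bat.dim_nil]; exact Nat.zero_le k))

theorem Pos.isBd_cons {P B : Bat} {L : List Bat} {i : pos.{u} P ⟶ pos.{u} (.br (B :: L))}
    {ε : Bool} {k : ℕ} (hi : Glob.IsBd i ε (k + 1)) :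
    ∃ (P₁ : Bat) (P₂ : List Bat) (i₁ : pos.{u} P₁ ⟶ pos.{u} B)
      (i₂ : pos.{u} (.br P₂) ⟶ pos.{u} (.br L)) (_ : Glob.IsBd i₁ ε k)
      (h₂ : Glob.IsBd i₂ ε (k + 1)), (⟨P, i⟩ : Σ P : Bat, (pos.{u} P ⟶ pos.{u} (.br (B :: L)))) =
        ⟨.br (P₁ :: P₂), Pos.consMap i₁ i₂ (PasteSq.isBd_map_here h₂)⟩ := by
  obtain ⟨P₁, i₁, h₁⟩ := exists_isBd.{u} B ε k
  obtain ⟨⟨P₂⟩, i₂, h₂⟩ := exists_isBd.{u} (.br L) ε (k + 1)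
  exact ⟨P₁, P₂, i₁, i₂, h₁, h₂, IsBd.unique hi (isBd_consMap _ _ _ h₁ h₂)⟩

/-- Trees can be pasted along a common boundary. -/
theorem exists_pasteSq (k : ℕ) (P U V : Bat) (i : pos.{u} P ⟶ pos.{u} U)
    (j : pos.{u} P ⟶ pos.{u} V) (hi : Glob.IsBd i true k) (hj : Glob.IsBd j false k) :
    ∃ (W : Bat) (a : pos.{u} U ⟶ pos.{u} W) (b : pos.{u} V ⟶ pos.{u} W),
      PasteSq true k i j a b := by
  induction k generalizing P U V with
  | zero =>
    induction U using Bat.ind generalizing P V with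
    | nil =>
      obtain ⟨rfl, h⟩ := Sigma.mk.inj_iff.1 (Pos.isBd_nil hi)
      obtain rfl := eq_of_heq h
      exact ⟨_, _, _, PasteSq.of_dim_le j hj (by rw [Bat.dim_nil])⟩
    | cons B L _ ih =>
      obtain ⟨Q, q, hq⟩ := Pos.exists_isBd.{u} (.br L) true 0
      have hq' : Glob.IsBd (q ≫ Pos.inrHom B L) true 0 := by
        -- Pasting `Q` itself on the other side is only a device: the `left` field of the enlarged
        -- square is the required statement about `q ≫ Pos.inrHom B L`.
        obtain ⟨⟨W⟩, a, b, S⟩ := ih Q Q q (𝟙 _) hq (Pos.isBd_id _ (Pos.IsBd.dim_le hq))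
        exact (S.inr B).left
      obtain ⟨rfl, h⟩ := Sigma.mk.inj_iff.1 (Pos.IsBd.unique hi hq')
      obtain rfl := eq_of_heq h
      obtain ⟨⟨W⟩, a, b, S⟩ := ih P V q j hq hj
      exact ⟨_, _, _, S.inr B⟩
  | succ k ihk =>
    induction U using Bat.ind generalizing P V with
    | nil =>
      obtain ⟨rfl, h⟩ := Sigma.mk.inj_iff.1 (Pos.isBd_nil hi)
      obtain rfl := eq_of_heq h
      exact ⟨_, _, _, PasteSq.of_dim_le j hj (by rw [Bat.dim_nil]; omega)⟩
    | cons B L _ ih =>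
      obtain ⟨P₁, P₂, i₁, i₂, h₁, h₂, h⟩ := Pos.isBd_cons hi
      obtain ⟨rfl, h⟩ := Sigma.mk.inj_iff.1 h
      obtain rfl := eq_of_heq h
      -- The common boundary now has a first branch, so `V` is not the one-point tree. Decomposing
      -- `P` along `U` and along `V` gives the same branches, and the pasting is done branch by
      -- branch.
      obtain ⟨_ | ⟨B', L'⟩⟩ := V
      · have := congrArg Sigma.fst (Pos.isBd_nil hj)
        simp at this
      · obtain ⟨P₁', P₂', j₁, j₂, h₁', h₂', h⟩ := Pos.isBd_cons hj
        obtain ⟨e, h⟩ := Sigma.mk.inj_iff.1 h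
        simp only [Bat.br.injEq, List.cons.injEq] at e
        obtain ⟨rfl, rfl⟩ := e
        obtain rfl := eq_of_heq h
        obtain ⟨W₁, a₁, b₁, S₁⟩ := ihk P₁ B B' i₁ j₁ h₁ h₁'
        obtain ⟨⟨W₂⟩, a₂, b₂, S₂⟩ := ih (.br P₂) (.br L') i₂ j₂ h₂ h₂'
        exact ⟨_, _, _, S₁.consMap S₂⟩

-- Trees as iterated pastings of disks

/-- Trees obtained from disks by pasting. -/
inductive Built : Bat → Prop
  | disc (n : ℕ) : Built (disc n)
  | paste {k : ℕ} {P U V W : Bat} (i : pos.{u} P ⟶ pos.{u} U) (j : pos.{u} P ⟶ pos.{u} V)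
      (a : pos.{u} U ⟶ pos.{u} W) (b : pos.{u} V ⟶ pos.{u} W) :
      PasteSq true k i j a b → Built U → Built V → Built W

/-- The first branch and the remaining ones meet in a single `0`-position; `k` suspensions turn this
into a pasting along dimension `k`. -/
theorem exists_pasteSq_susp (k : ℕ) (B : Bat) (L : List Bat) :
    ∃ (P : Bat) (i : pos.{u} P ⟶ pos.{u} (susp k (.br [B])))
      (j : pos.{u} P ⟶ pos.{u} (susp k (.br L)))
      (a : pos.{u} (susp k (.br [B])) ⟶ pos.{u} (susp k (.br (B :: L))))
      (b : pos.{u} (susp k (.br L)) ⟶ pos.{u} (susp k (.br (B :: L)))), PasteSq true k i j a b := by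
  induction k with
  | zero =>
    have h := Pos.isBd_pointMap ((Pos.mem_bd_here.{u} (.br L) _).2 rfl)
    exact ⟨_, _, _, _, _, (PasteSq.of_dim_le _ h (by rw [Bat.dim_nil])).inr B⟩
  | succ k ih =>
    obtain ⟨P, i, j, a, b, S⟩ := ih
    have h : (Bat.br []).dim ≤ k + 1 := by rw [Bat.dim_nil]; omega
    exact ⟨_, _, _, _, _, S.consMap (PasteSq.of_dim_le (𝟙 (pos.{u} (.br []))) (Pos.isBd_id _ h) h)⟩

/-- Arbitrary suspensions are needed for the induction: splitting off the first branch of `susp k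
(br (B :: L))` leaves `susp (k + 1) B`. -/
theorem built_susp (B : Bat) : ∀ k, Built.{u} (susp k B) := by
  induction B using Bat.ind with
  | nil => exact .disc
  | cons B L hB hL =>
    intro k
    obtain ⟨P, i, j, a, b, S⟩ := exists_pasteSq_susp.{u} k B L
    refine .paste i j a b S ?_ (hL k)
    rw [susp_br]
    exact hB (k + 1)

/-- Every tree is obtained from disks by pasting. -/
theorem built (B : Bat) : Built.{u} B := built_susp B 0

/-! ### Cells of free computads -/

/-- The free computad on a globular set. -/
abbrev Free (X : Glob.{u}) : Comp.{u} := freeComputad.obj X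

/-- The action of a homomorphism on cells. -/
def act {C D : Comp.{u}} (f : C ⟶ D) {n : ℕ} (c : C.Cells n) : D.Cells n :=
  (stage.{u} n).cellMap (Comp.Hom.app f n) c

/-- The cell given by a generator. -/
def var {X : Glob.{u}} {n : ℕ} (x : X.cell n) : (Free X).Cells n := (stage.{u} n).gen X x

/-- The coherence cells of a free computad. -/
def coh {X : Glob.{u}} {n : ℕ} (B : Bat) (hB : B.dim ≤ n + 1)
    (A : (stage.{u} n).sph ((stage.{u} n).free.obj (pos.{u} B))) (hA : A ∈ (stage.{u} n).full B)
    (τ : Free (pos.{u} B) ⟶ Free X) : (Free X).Cells (n + 1) :=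
  Stage.SCell.coh (S := stage.{u} n) B hB A hA (Comp.Hom.app τ (n + 1))

/-- The two cells of a sphere. -/
def sphFace {n : ℕ} {C : (stage.{u} n).Obj} (ε : Bool) (A : (stage.{u} n).sph C) :
    (stage.{u} n).cell C :=
  bif ε then (stage.{u} n).snd A else (stage.{u} n).fst A

section

variable {C D E : Comp.{u}} {X Y : Glob.{u}}

theorem act_id {n : ℕ} (c : C.Cells n) : act (𝟙 C) c = c := (stage.{u} n).cellMap_id c

theorem act_comp (f : C ⟶ D) (g : D ⟶ E) {n : ℕ} (c : C.Cells n) :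
    act (f ≫ g) c = act g (act f c) := (stage.{u} n).cellMap_comp _ _ c

theorem act_face (f : C ⟶ D) (ε : Bool) {n : ℕ} (c : C.Cells (n + 1)) :
    act f (C.cellGlob.face ε c) = D.cellGlob.face ε (act f c) :=
  Glob.app_face (cells.map f) ε c

theorem free_ext {f g : Free X ⟶ C} (h : ∀ n (x : X.cell n), act f (var x) = act g (var x)) :
    f = g := free_hom_ext h

theorem act_lift (g : X ⟶ cells.obj C) {n : ℕ} (x : X.cell n) :
    act (lift g) (var x) = Glob.Hom.app g n x := lift_gen g n x

theorem act_map (f : X ⟶ Y) {n : ℕ} (x : X.cell n) :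
    act (freeComputad.map f) (var x) = var (Glob.Hom.app f n x) := (stage.{u} n).gen_map f x

/-- The morphism of globular sets corresponding to a homomorphism out of a free computad. -/
def toGlob (f : Free X ⟶ C) : X ⟶ cells.obj C := unitApp X ≫ cells.map f

theorem toGlob_app (f : Free X ⟶ C) {n : ℕ} (x : X.cell n) :
    Glob.Hom.app (toGlob f) n x = act f (var x) := rfl

theorem lift_toGlob (f : Free X ⟶ C) : lift (toGlob f) = f :=
  free_ext fun _ x => by rw [act_lift, toGlob_app]

theorem toGlob_injective {f g : Free X ⟶ C} (h : toGlob f = toGlob g) : f = g := by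
  rw [← lift_toGlob f, h, lift_toGlob]

theorem toGlob_map_comp (f : X ⟶ Y) (g : Free Y ⟶ C) :
    toGlob (freeComputad.map f ≫ g) = f ≫ toGlob g :=
  Glob.hom_ext fun _ x => by
    rw [toGlob_app, act_comp, act_map, Glob.comp_app, toGlob_app]

theorem face_var (ε : Bool) {n : ℕ} (x : X.cell (n + 1)) :
    (Free X).cellGlob.face ε (var x) = var (X.face ε x) := (Glob.app_face (unitApp X) ε x).symm

theorem var_injective : ∀ {n : ℕ} {x y : X.cell n}, var x = var y → x = y
  | 0, _, _, h => h
  | _ + 1, _, _, h => Stage.PreCell.var.inj (congrArg Subtype.val h)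

theorem eq_var_zero (c : (Free X).Cells 0) : ∃ x : X.cell 0, c = var x := ⟨c, rfl⟩

theorem bdry_eq {n : ℕ} (c : (Free X).Cells (n + 1)) : (Free X).bdry c = cellTy c :=
  (stage.{u} n).sphMap_id _

theorem trunc_app (f : Free X ⟶ Free Y) (n : ℕ) :
    (trunc n).map (Comp.Hom.app f (n + 1)) = Comp.Hom.app f n := by
  have h := Comp.Hom.trunc_map f n
  have h₁ : (trunc n).map (Comp.Hom.app f (n + 1)) ≫ eqToHom ((Free Y).trunc_obj n) =
    (trunc n).map (Comp.Hom.app f (n + 1)) := Category.comp_id _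
  have h₂ : eqToHom ((Free X).trunc_obj n) ≫ Comp.Hom.app f n = Comp.Hom.app f n :=
    Category.id_comp _
  rw [← h₁, h, h₂]

end

section Coh

variable {X Y : Glob.{u}} {n : ℕ} (B : Bat) (hB : B.dim ≤ n + 1)
  (A : (stage.{u} n).sph ((stage.{u} n).free.obj (pos.{u} B))) (hA : A ∈ (stage.{u} n).full B)
  (τ : Free (pos.{u} B) ⟶ Free X)

theorem act_coh (f : Free X ⟶ Free Y) : act f (coh B hB A hA τ) = coh B hB A hA (τ ≫ f) := rfl

theorem face_coh (ε : Bool) :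
    (Free X).cellGlob.face ε (coh B hB A hA τ) =
      act τ (sphFace ε A : (Free (pos.{u} B)).Cells n) := by
  have h : (Free X).bdry (coh B hB A hA τ) = (stage.{u} n).sphMap (Comp.Hom.app τ n) A := by
    rw [bdry_eq, ← trunc_app τ n]
    rfl
  cases ε
  · exact (congrArg (stage.{u} n).fst h).trans ((stage.{u} n).fst_map _ _)
  · exact (congrArg (stage.{u} n).snd h).trans ((stage.{u} n).snd_map _ _)

theorem var_ne_coh (x : X.cell (n + 1)) : var x ≠ coh B hB A hA τ := fun h => by
  have h : Stage.PreCell.var x = Stage.PreCell.coh (S := stage.{u} n) B hB A hA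
    (Stage.SHom.base (Comp.Hom.app τ (n + 1))) _ := congrArg Subtype.val h
  cases h

/-- Components below `N` are truncations of the one at `N`, and above `N` there are no generators.
With `exists_app_eq` this lets the `(n+1)`-homomorphism inside a coherence be treated as a
homomorphism of computads. -/
theorem app_injective {N : ℕ} {Z : Glob.{u}} (hZ : ∀ m, N < m → IsEmpty (Z.cell m))
    {σ τ : Free Z ⟶ Free X} (h : Comp.Hom.app σ N = Comp.Hom.app τ N) : σ = τ := by
  have key : ∀ k m, m + k = N → Comp.Hom.app σ m = Comp.Hom.app τ m := by
    intro k
    induction k with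
    | zero => rintro m rfl; exact h
    | succ k ih =>
      intro m hm
      exact (trunc_app σ m).symm.trans
        ((congrArg (trunc m).map (ih (m + 1) (by omega))).trans (trunc_app τ m))
  refine free_ext fun m x => ?_
  by_cases hm : m ≤ N
  · unfold act
    rw [key (N - m) m (by omega)]
  · exact ((hZ m (by omega)).false x).elim

theorem exists_app_eq_aux {X Y : Glob.{u}} (N : ℕ)
    (f : (stage.{u} N).free.obj X ⟶ (stage.{u} N).free.obj Y) :
    ∃ F : ∀ m, m ≤ N → ((stage.{u} m).free.obj X ⟶ (stage.{u} m).free.obj Y),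
      (∀ m (h : m + 1 ≤ N), (trunc m).map (F (m + 1) h) = F m (Nat.le_of_succ_le h)) ∧
        F N le_rfl = f := by
  induction N with
  | zero =>
    refine ⟨fun m hm => (Nat.le_zero.1 hm).symm ▸ f, fun m h => by omega, rfl⟩
  | succ N ih =>
    obtain ⟨F, hF, hN⟩ := ih ((trunc N).map f)
    refine ⟨fun m hm => if h : m ≤ N then F m h else
      (show N + 1 = m by omega) ▸ f, fun m h => ?_, ?_⟩
    · by_cases hm : m + 1 ≤ N
      · simp only [hm, Nat.le_of_succ_le hm, dif_pos]
        exact hF m hm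
      · obtain rfl : m = N := by omega
        simp only [hm, le_refl, dif_pos]
        rw [hN]
        rfl
    · simp

/-- A homomorphism of `N`-computads out of the free `N`-computad on a globular set without cells of
dimension greater than `N` extends to a homomorphism of computads. -/
theorem exists_app_eq {N : ℕ} {Z : Glob.{u}} (hZ : ∀ m, N < m → IsEmpty (Z.cell m))
    (f : (stage.{u} N).free.obj Z ⟶ (stage.{u} N).free.obj X) :
    ∃ σ : Free Z ⟶ Free X, Comp.Hom.app σ N = f := by
  obtain ⟨F, hF, hN⟩ := exists_app_eq_aux N f
  -- Above `N` the extension is forced, the set of new generators being empty.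
  let up : ∀ m (_ : ¬ m + 1 ≤ N), ((stage.{u} m).free.obj Z ⟶ (stage.{u} m).free.obj X) →
      ((stage.{u} (m + 1)).free.obj Z ⟶ (stage.{u} (m + 1)).free.obj X) := fun m h g =>
    liftSucc g (fun x => ((hZ (m + 1) (by omega)).false x).elim) fun x =>
      ((hZ (m + 1) (by omega)).false x).elim
  let G : ∀ m, (stage.{u} m).free.obj Z ⟶ (stage.{u} m).free.obj X := fun m =>
    Nat.rec (F 0 (Nat.zero_le _)) (fun m g => if h : m + 1 ≤ N then F (m + 1) h else up m h g) m
  have hG : ∀ m (h : m ≤ N), G m = F m h := by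
    intro m h
    cases m with
    | zero => rfl
    | succ m => exact dif_pos h
  have hG' : ∀ m, (trunc m).map (G (m + 1)) = G m := by
    intro m
    by_cases h : m + 1 ≤ N
    · rw [hG _ h, hG m (Nat.le_of_succ_le h), hF]
    · have : G (m + 1) = up m h (G m) := dif_neg h
      rw [this]
      rfl
  refine ⟨⟨G, fun m => ?_⟩, (hG N le_rfl).trans hN⟩
  exact (Category.comp_id _).trans ((hG' m).trans (Category.id_comp _).symm)

theorem pos_isEmpty {B : Bat} {N : ℕ} (hB : B.dim ≤ N) (m : ℕ) (hm : N < m) :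
    IsEmpty ((pos.{u} B).cell m) :=
  ⟨fun p => by have := Pos.le_dim p; omega⟩

theorem eq_var_or_coh (c : (Free X).Cells (n + 1)) : (∃ x : X.cell (n + 1), c = var x) ∨
    ∃ (B : Bat) (hB : B.dim ≤ n + 1) (A : _) (hA : A ∈ (stage.{u} n).full B)
      (τ : Free (pos.{u} B) ⟶ Free X), c = coh B hB A hA τ := by
  obtain ⟨x, h⟩ | ⟨B, hB, A, hA, τ, h⟩ := Stage.SCell.eq_var_or_coh (S := stage.{u} n) c
  · exact .inl ⟨x, h⟩
  · obtain ⟨σ, rfl⟩ := exists_app_eq (X := X) (N := n + 1) (pos_isEmpty hB) τ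
    exact .inr ⟨B, hB, A, hA, σ, h⟩

theorem coh_injective {B B' : Bat} {hB : B.dim ≤ n + 1} {hB' : B'.dim ≤ n + 1} {A A'}
    {hA : A ∈ (stage.{u} n).full B} {hA' : A' ∈ (stage.{u} n).full B'}
    {τ : Free (pos.{u} B) ⟶ Free X} {τ' : Free (pos.{u} B') ⟶ Free X}
    (h : coh B hB A hA τ = coh B' hB' A' hA' τ') : B = B' ∧ A ≍ A' ∧ τ ≍ τ' := by
  obtain ⟨rfl, h₁, h₂, h₃⟩ := Stage.PreCell.coh.inj (congrArg Subtype.val h)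
  refine ⟨rfl, h₁, heq_of_eq (app_injective (N := n + 1) (pos_isEmpty hB) ?_)⟩
  refine Stage.SHom.ext (eq_of_heq h₂) (funext fun p => Subtype.ext ?_)
  exact congrFun (eq_of_heq h₃) p

/-- If a generator-preserving homomorphism sends a cell to a generator, the cell is one. -/
theorem eq_var_of_act_map {X Y : Glob.{u}} (f : X ⟶ Y) {n : ℕ} (c : (Free X).Cells n)
    (y : Y.cell n) (h : act (freeComputad.map f) c = var y) : ∃ x, c = var x := by
  cases n with
  | zero => exact eq_var_zero c
  | succ n =>
    obtain h' | ⟨B, hB, A, hA, τ, rfl⟩ := eq_var_or_coh c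
    · exact h'
    · rw [act_coh] at h
      exact absurd h.symm (var_ne_coh _ _ _ _ _ _)

/-- A generator-preserving map sends generators to generators and acts on a coherence by composition
alone, so the shape of a cell can be read off its image. This turns lifts of coherence cells into
lifts of `τ`. -/
theorem eq_coh_of_act_map {Z : Glob.{u}} (f : Z ⟶ X) (c : (Free Z).Cells (n + 1))
    (h : act (freeComputad.map f) c = coh B hB A hA τ) :
    ∃ τ' : Free (pos.{u} B) ⟶ Free Z, c = coh B hB A hA τ' ∧ τ' ≫ freeComputad.map f = τ := by
  obtain ⟨x, rfl⟩ | ⟨B', hB', A', hA', τ', rfl⟩ := eq_var_or_coh c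
  · rw [act_map] at h
    exact absurd h (var_ne_coh _ _ _ _ _ _)
  · rw [act_coh] at h
    obtain ⟨rfl, h₁, h₂⟩ := coh_injective h
    obtain rfl := eq_of_heq h₁
    exact ⟨τ', rfl, eq_of_heq h₂⟩

end Coh

/-- Induction on the cells of free computads. -/
theorem cell_induction {P : ∀ (X : Glob.{u}) (n : ℕ), (Free X).Cells n → Prop}
    (hvar : ∀ X n (x : X.cell n), P X n (var x))
    (hcoh : ∀ (X : Glob.{u}) n B hB A hA (τ : Free (pos.{u} B) ⟶ Free X),
      (∀ m (p : Pos.{u} B m), P X m (act τ (var (X := pos.{u} B) p))) →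
      (∀ (Y : Glob.{u}) m (c : (Free Y).Cells m), m ≤ n → P Y m c) →
      P X (n + 1) (coh B hB A hA τ)) (X : Glob.{u}) (n : ℕ) (c : (Free X).Cells n) : P X n c := by
  -- The outer induction on dimension handles the positions of `B` below `n + 1` and the faces of
  -- `A`; the inner one on expressions handles the positions of dimension `n + 1`.
  induction n using Nat.strong_induction_on generalizing X with
  | _ n ih =>
    cases n with
    | zero =>
      obtain ⟨x, hx⟩ := eq_var_zero c
      rw [hx]
      exact hvar X 0 x
    | succ n =>
      obtain ⟨c, hc⟩ := c
      induction c with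
      | var x => exact hvar X (n + 1) x
      | coh B hB A hA τ τV ihc =>
        obtain ⟨σ, hσ⟩ := exists_app_eq (X := X) (N := n + 1) (Z := pos.{u} B) (pos_isEmpty hB)
          (Stage.SHom.mk τ (fun p => ⟨τV p, (hc p).1⟩) fun p => (hc p).2)
        have h := hcoh X n B hB A hA σ (fun m p => ?_) fun Y m c hm => ih m (by omega) Y c
        · unfold coh at h
          rw [hσ] at h
          exact h
        · obtain hm | hm : m < n + 1 ∨ n + 1 ≤ m := by omega
          · exact ih m hm X _
          · obtain rfl : m = n + 1 := by have := Pos.le_dim p; omega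
            unfold act
            rw [hσ]
            exact ihc p (hc p).1

/-! ### Generator-preserving homomorphisms -/

theorem map_inj {X Y : Glob.{u}} {f g : X ⟶ Y} (h : freeComputad.map f = freeComputad.map g) :
    f = g :=
  Glob.hom_ext fun n x => var_injective (by rw [← act_map, h, act_map])

theorem genPres_of_forall {X Y : Glob.{u}} {f : Free X ⟶ Free Y}
    (h : ∀ n (x : X.cell n), ∃ y : Y.cell n, act f (var x) = var y) :
    ∃ g : X ⟶ Y, freeComputad.map g = f := by
  choose g hg using h
  refine ⟨Glob.homMk g fun ε n x => var_injective ?_, free_ext fun n x => ?_⟩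
  · rw [← hg, ← face_var, ← face_var, act_face, hg]
  · rw [act_map, hg]
    rfl

/-- The boundary of a generator is the pair of generators given by its faces, so a
generator-preserving map is automatically globular. In dimension `0` every cell is a generator. -/
theorem genPres_iff {X Y : Glob.{u}} {f : Free X ⟶ Free Y} :
    Comp.GenPres f ↔ ∃ g : X ⟶ Y, freeComputad.map g = f := by
  constructor
  · refine fun h => genPres_of_forall fun n x => ?_
    cases n with
    | zero => exact eq_var_zero _
    | succ n =>
      obtain ⟨y, hy⟩ := (h (n + 1)).2 x
      exact ⟨y, Subtype.ext hy⟩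
  · rintro ⟨g, rfl⟩ n
    induction n with
    | zero => trivial
    | succ n ih => exact ⟨ih, fun v => ⟨_, rfl⟩⟩

theorem act_map_injective {X Y : Glob.{u}} {f : X ⟶ Y} (hf : Glob.Inj f) {n : ℕ}
    {c d : (Free X).Cells n} (h : act (freeComputad.map f) c = act (freeComputad.map f) d) :
    c = d := by
  revert d
  revert hf f
  refine cell_induction (P := fun X n c => ∀ {f : X ⟶ Y}, Glob.Inj f → ∀ {d : (Free X).Cells n},
    act (freeComputad.map f) c = act (freeComputad.map f) d → c = d) ?_ ?_ X n c
  · intro X n x f hf d h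
    rw [act_map] at h
    obtain ⟨y, rfl⟩ := eq_var_of_act_map f d _ h.symm
    rw [act_map] at h
    rw [hf n (var_injective h)]
  · intro X n B hB A hA τ ih _ f hf d h
    rw [act_coh] at h
    obtain ⟨τ', rfl, hτ⟩ := eq_coh_of_act_map _ _ _ _ _ _ d h.symm
    congr 1
    refine free_ext fun m p => ih m p hf ?_
    rw [← act_comp, ← act_comp, hτ]

/-! ### Supports -/

/-- The support of a cell: the generators of the same dimension occurring in it. -/
def supp {X : Glob.{u}} : ∀ {n : ℕ}, (Free X).Cells n → Set (X.cell n)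
  | 0, c => {(c : X.cell 0)}
  | _ + 1, c => c.1.supp

section Supp

variable {X Y : Glob.{u}}

theorem supp_var {n : ℕ} (x : X.cell n) : supp (var x) = {x} := by
  cases n <;> rfl

theorem supp_coh {n : ℕ} {B : Bat} (hB : B.dim ≤ n + 1) (A) (hA : A ∈ (stage.{u} n).full B)
    (τ : Free (pos.{u} B) ⟶ Free X) :
    supp (coh B hB A hA τ) = ⋃ p : Pos.{u} B (n + 1), supp (act τ (var (X := pos.{u} B) p)) := rfl

theorem mem_supp_act (f : Free X ⟶ Free Y) {n : ℕ} (c : (Free X).Cells n) (y : Y.cell n) :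
    y ∈ supp (act f c) ↔ ∃ x ∈ supp c, y ∈ supp (act f (var x)) := by
  refine cell_induction (P := fun X n c => ∀ (f : Free X ⟶ Free Y) (y : Y.cell n),
    y ∈ supp (act f c) ↔ ∃ x ∈ supp c, y ∈ supp (act f (var x))) ?_ ?_ X n c f y
  · intro X n x f y
    rw [supp_var]
    exact ⟨fun h => ⟨x, rfl, h⟩, fun ⟨_, hx, h⟩ => hx ▸ h⟩
  · intro X n B hB A hA τ ih _ f y
    rw [act_coh, supp_coh, supp_coh, Set.mem_iUnion]
    constructor
    · rintro ⟨p, hp⟩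
      rw [act_comp, ih _ p] at hp
      obtain ⟨x, hx, hy⟩ := hp
      exact ⟨x, Set.mem_iUnion.2 ⟨p, hx⟩, hy⟩
    · rintro ⟨x, hx, hy⟩
      obtain ⟨p, hp⟩ := Set.mem_iUnion.1 hx
      exact ⟨p, by rw [act_comp, ih _ p]; exact ⟨x, hp, hy⟩⟩

end Supp

/-! ### Full spheres -/

theorem full_zero {B : Bat} {A : (stage.{u} 0).sph ((stage.{u} 0).free.obj (pos.{u} B))}
    (hA : A ∈ (stage.{u} 0).full B) (ε : Bool) :
    ∃ p ∈ (pos.{u} B).bd ε 0 0, (sphFace ε A : (Free (pos.{u} B)).Cells 0) = var p := by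
  cases ε
  · exact ⟨A.1, ⟨le_rfl, fun _ y hy => hA.1 ⟨y, hy⟩⟩, rfl⟩
  · exact ⟨A.2, ⟨le_rfl, fun _ y hy => hA.2 ⟨y, hy⟩⟩, rfl⟩

theorem supp_of_full {n : ℕ} {B : Bat}
    {A : (stage.{u} (n + 1)).sph ((stage.{u} (n + 1)).free.obj (pos.{u} B))}
    (hA : A ∈ (stage.{u} (n + 1)).full B) (ε : Bool) :
    supp (sphFace ε A : (Free (pos.{u} B)).Cells (n + 1)) = (pos.{u} B).bd ε (n + 1) (n + 1) := by
  have hs : srcBoundary B (n + 1) = (pos.{u} B).bd false (n + 1) (n + 1) := Set.ext fun p =>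
    ⟨fun h => ⟨le_rfl, fun _ y hy => h ⟨y, hy⟩⟩, fun h ⟨y, hy⟩ => h.2 rfl y hy⟩
  have ht : tgtBoundary B (n + 1) = (pos.{u} B).bd true (n + 1) (n + 1) := Set.ext fun p =>
    ⟨fun h => ⟨le_rfl, fun _ y hy => h ⟨y, hy⟩⟩, fun h ⟨y, hy⟩ => h.2 rfl y hy⟩
  cases ε
  · exact hA.1.trans hs
  · exact hA.2.1.trans ht

/-- Fullness is hereditary: both cells of a full sphere share a boundary which is again full,
allowing induction on dimension. -/
theorem exists_full_boundary {n : ℕ} {B : Bat}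
    {A : (stage.{u} (n + 1)).sph ((stage.{u} (n + 1)).free.obj (pos.{u} B))}
    (hA : A ∈ (stage.{u} (n + 1)).full B) :
    ∃ A' ∈ (stage.{u} n).full B, ∀ δ ε, (Free (pos.{u} B)).cellGlob.face ε
      (sphFace δ A : (Free (pos.{u} B)).Cells (n + 1)) =
        (sphFace ε A' : (Free (pos.{u} B)).Cells n) := by
  refine ⟨Stage.SSph.bd A, hA.2.2, fun δ ε => ?_⟩
  have h : ∀ δ, (Free (pos.{u} B)).bdry (sphFace δ A : (Free (pos.{u} B)).Cells (n + 1)) =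
      Stage.SSph.bd A := by
    intro δ
    rw [bdry_eq]
    cases δ
    · exact Stage.SSph.ty_fst A
    · exact Stage.SSph.ty_snd A
  cases ε
  · exact congrArg (stage.{u} n).fst (h δ)
  · exact congrArg (stage.{u} n).snd (h δ)

/-! ### Strongly generic homomorphisms -/

/-- Unique left lifting against generator-preserving homomorphisms, for squares with arbitrary
bottom side. -/
def StrongGeneric {X Y : Glob.{u}} (σ : Free X ⟶ Free Y) : Prop :=
  ∀ (Z W : Glob.{u}) (τ : Free X ⟶ Free Z) (s : Free Y ⟶ Free W) (g : Z ⟶ W),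
    σ ≫ s = τ ≫ freeComputad.map g → ∃! h : Free Y ⟶ Free Z, σ ≫ h = τ ∧ h ≫ freeComputad.map g = s

theorem StrongGeneric.generic {X Y : Glob.{u}} {σ : Free X ⟶ Free Y} (h : StrongGeneric σ) :
    Generic σ := by
  intro Z W τ f g _ hg e
  obtain ⟨g, rfl⟩ := genPres_iff.1 hg
  exact h Z W τ f g e

theorem StrongGeneric.hom_ext {X Y Z W : Glob.{u}} {σ : Free X ⟶ Free Y} (hσ : StrongGeneric σ)
    (g : Z ⟶ W) {h h' : Free Y ⟶ Free Z} (e : σ ≫ h = σ ≫ h') (e' : h ≫ freeComputad.map g = h' ≫ freeComputad.map g) :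
    h = h' :=
  (hσ Z W (σ ≫ h) (h ≫ freeComputad.map g) g (Category.assoc _ _ _).symm).unique ⟨rfl, rfl⟩
    ⟨e.symm, e'.symm⟩

theorem StrongGeneric.id (X : Glob.{u}) : StrongGeneric (𝟙 (Free X)) := by
  intro Z W τ s g e
  rw [Category.id_comp] at e
  exact ⟨τ, ⟨Category.id_comp _, e.symm⟩, fun h hh => by rw [← hh.1, Category.id_comp]⟩

/-- The first lift has bottom side `σ' ≫ s`, which need not preserve generators even when `s` does;
this is why the strong form is used. -/
theorem StrongGeneric.comp {X Y Y' : Glob.{u}} {σ : Free X ⟶ Free Y} {σ' : Free Y ⟶ Free Y'}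
    (hσ : StrongGeneric σ) (hσ' : StrongGeneric σ') : StrongGeneric (σ ≫ σ') := by
  intro Z W τ s g e
  rw [Category.assoc] at e
  obtain ⟨h, ⟨h₁, h₂⟩, hu⟩ := hσ Z W τ (σ' ≫ s) g e
  obtain ⟨k, ⟨k₁, k₂⟩, ku⟩ := hσ' Z W h s g h₂.symm
  refine ⟨k, ⟨by rw [Category.assoc, k₁, h₁], k₂⟩, fun k' hk' => ku k' ⟨hu _ ⟨?_, ?_⟩, hk'.2⟩⟩
  · rw [← Category.assoc, hk'.1]
  · rw [Category.assoc, hk'.2]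

/-- A generic factorisation maps to every other factorisation with generator-preserving right
factor. -/
theorem Generic.exists_map {X Y Y' W : Glob.{u}} {σ : Free X ⟶ Free Y}
    {τ : Free X ⟶ Free Y'} {f : Y ⟶ W} {g : Y' ⟶ W} (hσ : Generic σ) (h : σ ≫ freeComputad.map f = τ ≫ freeComputad.map g) :
    ∃ k : Y ⟶ Y', σ ≫ freeComputad.map k = τ ∧ k ≫ g = f := by
  obtain ⟨k, ⟨hk, hk'⟩, -⟩ := hσ _ _ τ (freeComputad.map f) (freeComputad.map g) (genPres_iff.2 ⟨f, rfl⟩)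
    (genPres_iff.2 ⟨g, rfl⟩) h
  -- The lift preserves generators because its composite with `g` does.
  obtain ⟨k, rfl⟩ := genPres_of_forall (f := k) fun n x =>
    eq_var_of_act_map g _ (Glob.Hom.app f n x) (by rw [← act_comp, hk', act_map])
  exact ⟨k, hk, map_inj (by rw [Functor.map_comp, hk'])⟩

/-- Generic factorisations through trees are unique. -/
theorem generic_factorisation_unique {P Q : Bat} {X W : Glob.{u}} {σ : Free X ⟶ Free (pos.{u} P)}
    {τ : Free X ⟶ Free (pos.{u} Q)} {f : pos.{u} P ⟶ W} {g : pos.{u} Q ⟶ W} (hσ : Generic σ)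
    (hτ : Generic τ) (h : σ ≫ freeComputad.map f = τ ≫ freeComputad.map g) :
    (⟨P, σ, f⟩ : Σ P : Bat, (Free X ⟶ Free (pos.{u} P)) × (pos.{u} P ⟶ W)) = ⟨Q, τ, g⟩ := by
  obtain ⟨k, hk, hk'⟩ := hσ.exists_map h
  obtain ⟨l, hl, hl'⟩ := hτ.exists_map h.symm
  have hlk : l ≫ k = 𝟙 _ := by
    refine map_inj ((hτ _ _ τ (freeComputad.map g) (freeComputad.map g) (genPres_iff.2 ⟨g, rfl⟩)
      (genPres_iff.2 ⟨g, rfl⟩) rfl).unique ⟨?_, ?_⟩ ⟨?_, ?_⟩)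
    · rw [Functor.map_comp, ← Category.assoc, hl, hk]
    · rw [← Functor.map_comp, Category.assoc, hk', hl']
    · rw [CategoryTheory.Functor.map_id, Category.comp_id]
    · rw [CategoryTheory.Functor.map_id, Category.id_comp]
  -- One composite suffices: `l` is a section of `k`, so `k` has the same image as the identity, and
  -- rigidity of trees makes it the identity.
  have := Pos.eq_of_image_eq k (𝟙 _) fun n y => ⟨fun _ => ⟨y, rfl⟩, fun _ =>
    ⟨Glob.Hom.app l n y, congrArg (fun f : pos.{u} Q ⟶ pos.{u} Q => Glob.Hom.app f n y) hlk⟩⟩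
  obtain ⟨rfl, e⟩ := Sigma.mk.inj_iff.1 this
  obtain rfl := eq_of_heq e
  rw [← hk', ← hk, CategoryTheory.Functor.map_id, Category.comp_id, Category.id_comp]

/-! ### Good homomorphisms between free computads on trees -/

/-- A strongly generic homomorphism between free computads on trees such that every position of the
target of at least the dimension of the source is in the support of the homomorphism. -/
structure Core {B U : Bat} (σ : Free (pos.{u} B) ⟶ Free (pos.{u} U)) : Prop where
  generic : StrongGeneric σ
  supp : ∀ m, B.dim ≤ m → ∀ x : Pos.{u} U m, ∃ p : Pos.{u} B m,
    x ∈ supp (act σ (var (X := pos.{u} B) p))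

/-- The `ε`-boundary of dimension `n` of a homomorphism between trees exists. -/
def HasBoundary {B U : Bat} (σ : Free (pos.{u} B) ⟶ Free (pos.{u} U)) (ε : Bool) (n : ℕ) : Prop :=
  ∃ (P Q : Bat) (i : pos.{u} P ⟶ pos.{u} B) (j : pos.{u} Q ⟶ pos.{u} U)
    (σ' : Free (pos.{u} P) ⟶ Free (pos.{u} Q)), Glob.IsBd i ε n ∧ Glob.IsBd j ε n ∧ Core σ' ∧
      freeComputad.map i ≫ σ = σ' ≫ freeComputad.map j

/-- A homomorphism between free computads on trees which is strongly generic, together with all its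
boundaries. -/
structure Good {B U : Bat} (σ : Free (pos.{u} B) ⟶ Free (pos.{u} U)) : Prop where
  core : Core σ
  hasBoundary : ∀ ε n, HasBoundary σ ε n

theorem Core.dim_le {B U : Bat} {σ : Free (pos.{u} B) ⟶ Free (pos.{u} U)} (h : Core σ) :
    U.dim ≤ B.dim := by
  by_contra! hlt
  obtain ⟨x⟩ := Pos.nonempty_dim.{u} U
  obtain ⟨p, -⟩ := h.supp _ hlt.le x
  exact absurd (Pos.le_dim p) (by omega)

theorem Core.comp {B U V : Bat} {σ : Free (pos.{u} B) ⟶ Free (pos.{u} U)}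
    {τ : Free (pos.{u} U) ⟶ Free (pos.{u} V)} (hσ : Core σ) (hτ : Core τ) : Core (σ ≫ τ) where
  generic := hσ.generic.comp hτ.generic
  supp m hm x := by
    obtain ⟨y, hy⟩ := hτ.supp m (hσ.dim_le.trans hm) x
    obtain ⟨p, hp⟩ := hσ.supp m hm y
    exact ⟨p, by rw [act_comp, mem_supp_act]; exact ⟨y, hp, hy⟩⟩

theorem Core.id (B : Bat) : Core (𝟙 (Free (pos.{u} B))) where
  generic := StrongGeneric.id _
  supp m _ x := ⟨x, by rw [act_id, supp_var]; rfl⟩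

theorem Good.id (B : Bat) : Good (𝟙 (Free (pos.{u} B))) where
  core := Core.id B
  hasBoundary ε n := by
    obtain ⟨P, i, hi⟩ := Pos.exists_isBd.{u} B ε n
    exact ⟨P, P, i, i, 𝟙 _, hi, hi, Core.id P, by rw [Category.id_comp, Category.comp_id]⟩

/-- From dimension `B.dim` on, both boundaries are the whole trees, as `U.dim ≤ B.dim`, and `σ` is
its own boundary. -/
theorem Good.of_lt {B U : Bat} {σ : Free (pos.{u} B) ⟶ Free (pos.{u} U)} (h : Core σ)
    (h' : ∀ ε n, n < B.dim → HasBoundary σ ε n) : Good σ where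
  core := h
  hasBoundary ε n := by
    by_cases hn : n < B.dim
    · exact h' ε n hn
    · have := h.dim_le
      exact ⟨B, U, 𝟙 _, 𝟙 _, σ, Pos.isBd_id ε (by omega), Pos.isBd_id ε (by omega), h, by
        rw [CategoryTheory.Functor.map_id, CategoryTheory.Functor.map_id, Category.id_comp, Category.comp_id]⟩

theorem Good.exists_boundary {B U P : Bat} {σ : Free (pos.{u} B) ⟶ Free (pos.{u} U)} (h : Good σ)
    {ε : Bool} {n : ℕ} {i : pos.{u} P ⟶ pos.{u} B} (hi : Glob.IsBd i ε n) :
    ∃ (Q : Bat) (j : pos.{u} Q ⟶ pos.{u} U) (σ' : Free (pos.{u} P) ⟶ Free (pos.{u} Q)),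
      Glob.IsBd j ε n ∧ Core σ' ∧ freeComputad.map i ≫ σ = σ' ≫ freeComputad.map j := by
  obtain ⟨P', Q, i', j, σ', hi', hj, hσ', e⟩ := h.hasBoundary ε n
  obtain ⟨rfl, h⟩ := Sigma.mk.inj_iff.1 (Pos.IsBd.unique hi hi')
  obtain rfl := eq_of_heq h
  exact ⟨Q, j, σ', hj, hσ', e⟩

/-- The homomorphism factors as a good homomorphism followed by a generator-preserving one. -/
def HasGood {B : Bat} {X : Glob.{u}} (σ : Free (pos.{u} B) ⟶ Free X) : Prop :=
  ∃ (U : Bat) (σ' : Free (pos.{u} B) ⟶ Free (pos.{u} U)) (f : pos.{u} U ⟶ X),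
    Good σ' ∧ σ' ≫ freeComputad.map f = σ

theorem free_mono {X Y Z : Glob.{u}} {f : Y ⟶ Z} (hf : Glob.Inj f) {σ τ : Free X ⟶ Free Y}
    (h : σ ≫ freeComputad.map f = τ ≫ freeComputad.map f) : σ = τ :=
  free_ext fun n x => act_map_injective hf (by rw [← act_comp, h, act_comp])

namespace PasteSq

variable {ε : Bool} {k : ℕ} {P U V W : Bat} {i : pos.{u} P ⟶ pos.{u} U} {j : pos.{u} P ⟶ pos.{u} V}
  {a : pos.{u} U ⟶ pos.{u} W} {b : pos.{u} V ⟶ pos.{u} W}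

/-- As a left adjoint, `freeComputad` preserves the pushout; the argument transposes the data to
globular sets. -/
theorem exists_freeDesc (S : PasteSq ε k i j a b) {X : Glob.{u}} (f : Free (pos.{u} U) ⟶ Free X)
    (g : Free (pos.{u} V) ⟶ Free X) (h : freeComputad.map i ≫ f = freeComputad.map j ≫ g) :
    ∃ m : Free (pos.{u} W) ⟶ Free X, freeComputad.map a ≫ m = f ∧ freeComputad.map b ≫ m = g := by
  obtain ⟨m, h₁, h₂⟩ := S.exists_desc (toGlob f) (toGlob g) (by
    rw [← toGlob_map_comp, ← toGlob_map_comp, h])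
  have hm : toGlob (lift m) = m := Glob.hom_ext fun n x => by rw [toGlob_app, act_lift]
  exact ⟨lift m, toGlob_injective (by rw [toGlob_map_comp, hm, h₁]),
    toGlob_injective (by rw [toGlob_map_comp, hm, h₂])⟩

theorem free_hom_ext (S : PasteSq ε k i j a b) {X : Glob.{u}} {m m' : Free (pos.{u} W) ⟶ Free X}
    (h₁ : freeComputad.map a ≫ m = freeComputad.map a ≫ m') (h₂ : freeComputad.map b ≫ m = freeComputad.map b ≫ m') : m = m' := by
  refine free_ext (S.app_ext (p := fun n w => act m (var (X := pos.{u} W) w) =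
    act m' (var (X := pos.{u} W) w)) (fun n x => ?_) fun n y => ?_)
  · rw [← act_map, ← act_comp, h₁, act_comp]
  · rw [← act_map, ← act_comp, h₂, act_comp]

theorem exists_core (S : PasteSq ε k i j a b) {ε' : Bool} {k' : ℕ} {P' U' V' W' : Bat}
    {i' : pos.{u} P' ⟶ pos.{u} U'} {j' : pos.{u} P' ⟶ pos.{u} V'} {a' : pos.{u} U' ⟶ pos.{u} W'}
    {b' : pos.{u} V' ⟶ pos.{u} W'} (S' : PasteSq ε' k' i' j' a' b')
    {σ₀ : Free (pos.{u} P) ⟶ Free (pos.{u} P')} {σ₁ : Free (pos.{u} U) ⟶ Free (pos.{u} U')}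
    {σ₂ : Free (pos.{u} V) ⟶ Free (pos.{u} V')} (h₀ : StrongGeneric σ₀) (h₁ : Core σ₁)
    (h₂ : Core σ₂) (e₁ : freeComputad.map i ≫ σ₁ = σ₀ ≫ freeComputad.map i') (e₂ : freeComputad.map j ≫ σ₂ = σ₀ ≫ freeComputad.map j') :
    ∃ σ : Free (pos.{u} W) ⟶ Free (pos.{u} W'), Core σ ∧ freeComputad.map a ≫ σ = σ₁ ≫ freeComputad.map a' ∧
      freeComputad.map b ≫ σ = σ₂ ≫ freeComputad.map b' := by
  obtain ⟨σ, ha, hb⟩ := S.exists_freeDesc (σ₁ ≫ freeComputad.map a') (σ₂ ≫ freeComputad.map b') (by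
    rw [← Category.assoc, e₁, ← Category.assoc, e₂, Category.assoc, Category.assoc,
      ← Functor.map_comp, ← Functor.map_comp, S'.comm])
  refine ⟨σ, ⟨?_, ?_⟩, ha, hb⟩
  · intro Z Y τ s g e
    obtain ⟨f₁, ⟨hf₁, hf₁'⟩, u₁⟩ := h₁.generic Z Y (freeComputad.map a ≫ τ) (freeComputad.map a' ≫ s) g (by
      rw [← Category.assoc, ← ha, Category.assoc, e, Category.assoc])
    obtain ⟨f₂, ⟨hf₂, hf₂'⟩, u₂⟩ := h₂.generic Z Y (freeComputad.map b ≫ τ) (freeComputad.map b' ≫ s) g (by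
      rw [← Category.assoc, ← hb, Category.assoc, e, Category.assoc])
    -- The lifts on the two pieces agree over `P'`, since both restrict to solutions of one lifting
    -- problem for `σ₀`; only its uniqueness part is used.
    obtain ⟨m, hm₁, hm₂⟩ := S'.exists_freeDesc f₁ f₂ (by
      refine h₀.hom_ext g ?_ ?_
      · rw [← Category.assoc, ← e₁, ← Category.assoc, ← e₂, Category.assoc, Category.assoc, hf₁,
          hf₂, ← Category.assoc, ← Category.assoc, ← Functor.map_comp, ← Functor.map_comp, S.comm]
      · rw [Category.assoc, Category.assoc, hf₁', hf₂', ← Category.assoc, ← Category.assoc,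
          ← Functor.map_comp, ← Functor.map_comp, S'.comm])
    refine ⟨m, ⟨S.free_hom_ext ?_ ?_, S'.free_hom_ext ?_ ?_⟩, ?_⟩
    · rw [← Category.assoc, ha, Category.assoc, hm₁, hf₁]
    · rw [← Category.assoc, hb, Category.assoc, hm₂, hf₂]
    · rw [← Category.assoc, hm₁, hf₁']
    · rw [← Category.assoc, hm₂, hf₂']
    · rintro m' ⟨hm', hm''⟩
      refine S'.free_hom_ext ?_ ?_
      · rw [hm₁]
        refine u₁ _ ⟨?_, ?_⟩
        · rw [← Category.assoc, ← ha, Category.assoc, hm']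
        · rw [Category.assoc, hm'']
      · rw [hm₂]
        refine u₂ _ ⟨?_, ?_⟩
        · rw [← Category.assoc, ← hb, Category.assoc, hm']
        · rw [Category.assoc, hm'']
  · intro m hm w
    have hdim : ∀ {U : Bat} (a : pos.{u} U ⟶ pos.{u} W), U.dim ≤ m := fun {U} a => by
      obtain ⟨x⟩ := Pos.nonempty_dim.{u} U
      exact (Pos.le_dim (Glob.Hom.app a _ x : Pos.{u} W _)).trans hm
    have haux : ∀ {U U' : Bat} {a : pos.{u} U ⟶ pos.{u} W} {a' : pos.{u} U' ⟶ pos.{u} W'}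
        {σ₁ : Free (pos.{u} U) ⟶ Free (pos.{u} U')}, Core σ₁ → freeComputad.map a ≫ σ = σ₁ ≫ freeComputad.map a' →
        ∀ x : Pos.{u} U' m, ∃ p : Pos.{u} W m,
          Glob.Hom.app a' m x ∈ supp (act σ (var (X := pos.{u} W) p)) := by
      intro U U' a a' σ₁ h₁ ha x
      obtain ⟨p, hp⟩ := h₁.supp m (hdim a) x
      refine ⟨Glob.Hom.app a m p, ?_⟩
      rw [← act_map, ← act_comp, ha, act_comp, mem_supp_act]
      exact ⟨x, hp, by rw [act_map, supp_var]; rfl⟩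
    obtain ⟨x, rfl⟩ | ⟨y, rfl⟩ := S'.surj m w
    · exact haux h₁ ha x
    · exact haux h₂ hb y

/-- Good factorisations can be pasted. -/
theorem hasGood (S : PasteSq true k i j a b) {X : Glob.{u}} {σ : Free (pos.{u} W) ⟶ Free X}
    (h₁ : HasGood (freeComputad.map a ≫ σ)) (h₂ : HasGood (freeComputad.map b ≫ σ)) : HasGood σ := by
  obtain ⟨U', σ₁, f₁, g₁, e₁⟩ := h₁
  obtain ⟨V', σ₂, f₂, g₂, e₂⟩ := h₂
  obtain ⟨P', i', σ₀, hi', h₀, c₁⟩ := g₁.exists_boundary S.left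
  obtain ⟨P'', j', σ₀', hj', h₀', c₂⟩ := g₂.exists_boundary S.right
  -- Both boundary restrictions factor the same homomorphism out of `Free P`, so they coincide, and
  -- `U'` and `V'` acquire a common boundary along which to paste.
  have hu := generic_factorisation_unique (σ := σ₀) (τ := σ₀') (f := i' ≫ f₁) (g := j' ≫ f₂)
    h₀.generic.generic h₀'.generic.generic (by
      rw [Functor.map_comp, Functor.map_comp, ← Category.assoc, ← c₁, ← Category.assoc, ← c₂,
        Category.assoc, Category.assoc, e₁, e₂, ← Category.assoc, ← Category.assoc,
        ← Functor.map_comp, ← Functor.map_comp, S.comm])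
  obtain ⟨rfl, hu⟩ := Sigma.mk.inj_iff.1 hu
  obtain ⟨rfl, hf⟩ := Prod.mk.inj (eq_of_heq hu)
  obtain ⟨W', a', b', S'⟩ := exists_pasteSq k P' U' V' i' j' hi' hj'
  obtain ⟨σ', hσ', ha, hb⟩ := S.exists_core S' h₀.generic g₁.core g₂.core c₁ c₂
  obtain ⟨f, hfa, hfb⟩ := S'.exists_desc f₁ f₂ hf
  refine ⟨W', σ', f, Good.of_lt hσ' fun δ n hn => ?_, S.free_hom_ext ?_ ?_⟩
  -- Below `k` the boundary is that of one piece; at `k` the source comes from `U` and the target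
  -- from `V`; above `k` the boundaries of the two pieces are pasted, again along `σ₀`.
  · obtain hnk | rfl | hnk := lt_trichotomy n k
    · obtain ⟨R, Q, r, q, ρ, hr, hq, hρ, e⟩ := g₁.hasBoundary δ n
      refine ⟨R, Q, r ≫ a, q ≫ a', ρ, S.isBd_lt hnk hr, S'.isBd_lt hnk hq, hρ, ?_⟩
      rw [Functor.map_comp, Category.assoc, ha, ← Category.assoc, e, Category.assoc,
        ← Functor.map_comp]
    · cases δ with
      | false =>
        obtain ⟨R, Q, r, q, ρ, hr, hq, hρ, e⟩ := g₁.hasBoundary false n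
        refine ⟨R, Q, r ≫ a, q ≫ a', ρ, S.isBd_eq hr, S'.isBd_eq hq, hρ, ?_⟩
        rw [Functor.map_comp, Category.assoc, ha, ← Category.assoc, e, Category.assoc,
          ← Functor.map_comp]
      | true =>
        obtain ⟨R, Q, r, q, ρ, hr, hq, hρ, e⟩ := g₂.hasBoundary true n
        refine ⟨R, Q, r ≫ b, q ≫ b', ρ, S.swap.isBd_eq hr, S'.swap.isBd_eq hq, hρ, ?_⟩
        rw [Functor.map_comp, Category.assoc, hb, ← Category.assoc, e, Category.assoc,
          ← Functor.map_comp]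
    · obtain ⟨R₁, Q₁, r₁, q₁, ρ₁, hr₁, hq₁, hρ₁, d₁⟩ := g₁.hasBoundary δ n
      obtain ⟨R₂, Q₂, r₂, q₂, ρ₂, hr₂, hq₂, hρ₂, d₂⟩ := g₂.hasBoundary δ n
      obtain ⟨R, r, hr⟩ := Pos.exists_isBd.{u} W δ n
      obtain ⟨Q, q, hq⟩ := Pos.exists_isBd.{u} W' δ n
      obtain ⟨i₁, j₁, a₁, b₁, hi₁, hj₁, ha₁, hb₁, S₁⟩ := S.exists_boundary hnk hr hr₁ hr₂
      obtain ⟨i₂, j₂, a₂, b₂, hi₂, hj₂, ha₂, hb₂, S₂⟩ := S'.exists_boundary hnk hq hq₁ hq₂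
      obtain ⟨ρ, hρ, hρa, hρb⟩ := S₁.exists_core S₂ (σ₀ := σ₀) h₀.generic hρ₁ hρ₂
        (free_mono (Pos.inj q₁) (by
          rw [Category.assoc, ← d₁, ← Category.assoc, ← Functor.map_comp, hi₁, c₁, Category.assoc,
            ← Functor.map_comp, hi₂]))
        (free_mono (Pos.inj q₂) (by
          rw [Category.assoc, ← d₂, ← Category.assoc, ← Functor.map_comp, hj₁, c₂, Category.assoc,
            ← Functor.map_comp, hj₂]))
      refine ⟨R, Q, r, q, ρ, hr, hq, hρ, S₁.free_hom_ext ?_ ?_⟩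
      · rw [← Category.assoc, ← Functor.map_comp, ha₁, Functor.map_comp, Category.assoc, ha,
          ← Category.assoc, d₁, ← Category.assoc, hρa, Category.assoc, Category.assoc,
          ← Functor.map_comp, ← Functor.map_comp, ha₂]
      · rw [← Category.assoc, ← Functor.map_comp, hb₁, Functor.map_comp, Category.assoc, hb,
          ← Category.assoc, d₂, ← Category.assoc, hρb, Category.assoc, Category.assoc,
          ← Functor.map_comp, ← Functor.map_comp, hb₂]
  · rw [← Category.assoc, ha, Category.assoc, ← Functor.map_comp, hfa, e₁]
  · rw [← Category.assoc, hb, Category.assoc, ← Functor.map_comp, hfb, e₂]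

end PasteSq

/-! ### Cells as homomorphisms out of disks -/

/-- The homomorphism out of the free computad on a disk given by a cell. -/
def cellHom {X : Glob.{u}} {n : ℕ} (c : (Free X).Cells n) : Free (pos.{u} (disc n)) ⟶ Free X :=
  lift (disc.map n (cells.obj (Free X)) c)

section

variable {X Y : Glob.{u}} {n : ℕ}

theorem act_cellHom (c : (Free X).Cells n) :
    act (cellHom c) (var (X := pos.{u} (disc n)) (disc.top n)) = c := by
  rw [cellHom, act_lift, disc.map_top]

theorem disc_free_hom_ext {f g : Free (pos.{u} (disc n)) ⟶ Free X}
    (h : act f (var (X := pos.{u} (disc n)) (disc.top n)) =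
      act g (var (X := pos.{u} (disc n)) (disc.top n))) : f = g :=
  toGlob_injective (disc.hom_ext h)

theorem cellHom_act (f : Free (pos.{u} (disc n)) ⟶ Free X) :
    cellHom (act f (var (X := pos.{u} (disc n)) (disc.top n))) = f :=
  disc_free_hom_ext (act_cellHom _)

theorem cellHom_comp (c : (Free X).Cells n) (f : Free X ⟶ Free Y) :
    cellHom c ≫ f = cellHom (act f c) :=
  disc_free_hom_ext (by rw [act_comp, act_cellHom, act_cellHom])

theorem cellHom_var (x : X.cell n) : cellHom (var x) = freeComputad.map (disc.map n X x) :=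
  disc_free_hom_ext (by rw [act_cellHom, act_map, disc.map_top])

theorem incl_cellHom (ε : Bool) (c : (Free X).Cells (n + 1)) :
    freeComputad.map (disc.incl ε n) ≫ cellHom c = cellHom ((Free X).cellGlob.face ε c) :=
  disc_free_hom_ext (by
    rw [act_comp, act_map, act_cellHom, disc.incl, disc.map_top, ← face_var, act_face, act_cellHom])

end

/-- Pasting reduces a tree to disks, and on a disk `σ` is the cell picked out by the top position.
-/
theorem Built.hasGood {B : Bat} (hB : Built.{u} B) {X : Glob.{u}} (σ : Free (pos.{u} B) ⟶ Free X)
    (h : ∀ m (p : Pos.{u} B m), HasGood (cellHom (act σ (var (X := pos.{u} B) p)))) :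
    HasGood σ := by
  induction hB with
  | disc n =>
    have := h n (disc.top n)
    rwa [cellHom_act] at this
  | paste i j a b S _ _ ih₁ ih₂ =>
    refine S.hasGood (ih₁ _ fun m p => ?_) (ih₂ _ fun m p => ?_)
    · rw [act_comp, act_map]
      exact h m _
    · rw [act_comp, act_map]
      exact h m _

/-! ### Full spheres -/

/-- A position of dimension at most `n` lies in the source `n`-boundary or is an `n`-dimensional
target. In the latter case `Pos.face_mem_bd` makes it the target of a position of the `ε`-boundary.
Hence the top dimension and the source `n`-boundary control the whole image. -/
theorem isBd_of_boundary {P B : Bat} {n : ℕ} {ε : Bool} (f : pos.{u} P ⟶ pos.{u} B)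
    (hP : P.dim ≤ n + 1)
    (h : ∃ (Q : Bat) (j : pos.{u} Q ⟶ pos.{u} P), Glob.IsBd (j ≫ f) false n)
    (h' : ∀ y, (∃ x, Glob.Hom.app f (n + 1) x = y) ↔ y ∈ (pos.{u} B).bd ε (n + 1) (n + 1)) :
    Glob.IsBd f ε (n + 1) := by
  obtain ⟨Q, j, hj⟩ := h
  intro m y
  obtain hm | rfl | hm := lt_trichotomy m (n + 1)
  · refine ⟨fun _ => ⟨hm.le, fun h => by omega⟩, fun _ => ?_⟩
    by_cases hy : y ∈ (pos.{u} B).bd false n m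
    · obtain ⟨x, hx⟩ := (hj m y).2 hy
      exact ⟨Glob.Hom.app j m x, hx⟩
    · obtain rfl : m = n := by
        by_contra hmn
        exact hy ⟨by omega, fun h => absurd h hmn⟩
      obtain ⟨z, rfl⟩ : ∃ z, (pos.{u} B).face true z = y := by
        by_contra! hz
        exact hy ⟨le_rfl, fun _ => hz⟩
      obtain ⟨w, hw, hwz⟩ := Pos.face_mem_bd B ε true (Nat.lt_succ_self m) z
      obtain ⟨x, rfl⟩ := (h' w).2 hw
      exact ⟨(pos.{u} P).face true x, by rw [Glob.app_face, hwz]⟩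
  · exact h' y
  · refine ⟨fun ⟨x, _⟩ => ?_, fun hy => ?_⟩
    · have := Pos.le_dim x
      omega
    · have := hy.1
      omega

/-- Factor the face of `A` as `α` followed by `f`. Every top position of `P` is in the support of
`α`, so `f` has the support of the face as its image in that dimension, and this is the boundary by
fullness. Lower dimensions follow by induction. -/
theorem exists_good_of_full (n : ℕ)
    (hg : ∀ (Y : Glob.{u}) m (c : (Free Y).Cells m), m ≤ n → HasGood (cellHom c)) (B : Bat)
    (A : (stage.{u} n).sph ((stage.{u} n).free.obj (pos.{u} B))) (hA : A ∈ (stage.{u} n).full B)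
    (ε : Bool) : ∃ (P : Bat) (α : Free (pos.{u} (disc n)) ⟶ Free (pos.{u} P))
      (i : pos.{u} P ⟶ pos.{u} B), Good α ∧ Glob.IsBd i ε n ∧
        α ≫ freeComputad.map i = cellHom (sphFace ε A : (Free (pos.{u} B)).Cells n) := by
  induction n generalizing ε with
  | zero =>
    obtain ⟨p, hp, h⟩ := full_zero hA ε
    exact ⟨_, 𝟙 _, _, Good.id _, Pos.isBd_pointMap hp, by
      rw [h, cellHom_var, Category.id_comp]; rfl⟩
  | succ n ih =>
    obtain ⟨P, α, f, hα, e⟩ := hg _ _ (sphFace ε A : (Free (pos.{u} B)).Cells (n + 1)) le_rfl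
    obtain ⟨A', hA', hface⟩ := exists_full_boundary hA
    refine ⟨P, α, f, hα, isBd_of_boundary f ?_ ?_ ?_, e⟩
    · exact hα.core.dim_le.trans (disc.dim_eq (n + 1)).le
    -- The source face of the cell is also the source face of the full sphere `A'`. The
    -- factorisation through the boundary of `α` and the inductive one through the boundary of `B`
    -- agree by uniqueness.
    · obtain ⟨Q, β, i, hβ, hi, e'⟩ := ih (fun Y m c hm => hg Y m c (by omega)) A' hA' false
      obtain ⟨R, j, γ, hj, hγ, e''⟩ := hα.exists_boundary (disc.isBd_incl false n)
      have := generic_factorisation_unique (σ := γ) (τ := β) (f := j ≫ f) (g := i)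
        hγ.generic.generic hβ.core.generic.generic (by
          rw [Functor.map_comp, ← Category.assoc, ← e'', Category.assoc, e, incl_cellHom, hface, e'])
      obtain ⟨rfl, h⟩ := Sigma.mk.inj_iff.1 this
      obtain ⟨-, rfl⟩ := Prod.mk.inj (eq_of_heq h)
      exact ⟨_, j, hi⟩
    · intro y
      rw [← supp_of_full hA ε, ← act_cellHom (sphFace ε A : (Free (pos.{u} B)).Cells (n + 1)), ← e,
        act_comp, mem_supp_act]
      constructor
      · rintro ⟨x, rfl⟩
        obtain ⟨p, hp⟩ := hα.core.supp (n + 1) (disc.dim_eq (n + 1)).le x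
        rw [disc.eq_top p] at hp
        exact ⟨x, hp, by rw [act_map, supp_var]; rfl⟩
      · rintro ⟨x, -, hx⟩
        rw [act_map, supp_var] at hx
        exact ⟨x, hx.symm⟩

/-! ### Generic factorisations -/

/-- A lift of the coherence cell is the same as a lift of `τ`, and its support is the union of the
supports of `τ`. Its faces are those of `A` followed by `τ`, so fullness writes them as a good `α`
followed by a boundary of `τ`. -/
theorem good_coh {n : ℕ} {B U : Bat} (hB : B.dim ≤ n + 1) (A) (hA : A ∈ (stage.{u} n).full B)
    {τ : Free (pos.{u} B) ⟶ Free (pos.{u} U)} (hτ : Good τ)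
    (hg : ∀ (Y : Glob.{u}) m (c : (Free Y).Cells m), m ≤ n → HasGood (cellHom c)) :
    Good (cellHom (coh B hB A hA τ)) := by
  refine Good.of_lt ⟨?_, ?_⟩ ?_
  · intro Z W t s g e
    rw [cellHom_comp, act_coh] at e
    have e' := congrArg (fun f => act f (var (X := pos.{u} (disc (n + 1))) (disc.top (n + 1)))) e
    simp only [act_cellHom, act_comp] at e'
    obtain ⟨τ', ht, hτ'⟩ := eq_coh_of_act_map _ _ _ _ _ _ _ e'.symm
    have ht' : t = cellHom (coh B hB A hA τ') := by rw [← ht, cellHom_act]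
    obtain ⟨h, ⟨h₁, h₂⟩, hu⟩ := hτ.core.generic Z W τ' s g hτ'.symm
    refine ⟨h, ⟨?_, h₂⟩, fun h' hh' => hu h' ⟨?_, hh'.2⟩⟩
    · rw [cellHom_comp, act_coh, h₁, ht']
    · have := hh'.1
      rw [cellHom_comp, act_coh, ht'] at this
      have := congrArg (fun f => act f (var (X := pos.{u} (disc (n + 1))) (disc.top (n + 1)))) this
      simp only [act_cellHom] at this
      exact eq_of_heq (coh_injective this).2.2
  · intro m hm x
    obtain rfl : m = n + 1 := by
      have h₁ := Pos.le_dim x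
      have h₂ := hτ.core.dim_le
      rw [disc.dim_eq] at hm
      omega
    obtain ⟨p, hp⟩ := hτ.core.supp (n + 1) hB x
    refine ⟨disc.top (n + 1), ?_⟩
    rw [act_cellHom, supp_coh]
    exact Set.mem_iUnion.2 ⟨p, hp⟩
  · intro ε k hk
    rw [disc.dim_eq] at hk
    obtain ⟨P, α, i, hα, hi, e⟩ := exists_good_of_full n hg B A hA ε
    have key : freeComputad.map (disc.incl ε n) ≫ cellHom (coh B hB A hA τ) = α ≫ freeComputad.map i ≫ τ := by
      rw [incl_cellHom, face_coh, ← Category.assoc, e, cellHom_comp]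
    obtain hk | rfl := lt_or_eq_of_le (Nat.lt_succ_iff.1 hk)
    -- Below `n` boundaries may be taken inside the `n`-boundaries: first that of `α`, then that of
    -- `τ`.
    · obtain ⟨R, r, hr⟩ := Pos.exists_isBd.{u} (disc n) ε k
      obtain ⟨Q, q, α', hq, hα', e₁⟩ := hα.exists_boundary hr
      obtain ⟨V, v, τ', hv, hτ', e₂⟩ := hτ.exists_boundary ((Pos.isBd_comp_iff hi ε hk).2 hq)
      refine ⟨R, V, r ≫ disc.incl ε n, v, α' ≫ τ',
        (Pos.isBd_comp_iff (disc.isBd_incl ε n) ε hk).2 hr, hv, hα'.comp hτ', ?_⟩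
      rw [Functor.map_comp, Category.assoc, key, ← Category.assoc, e₁, Category.assoc,
        Category.assoc, ← e₂, Functor.map_comp, Category.assoc]
    · obtain ⟨V, v, τ', hv, hτ', e₂⟩ := hτ.exists_boundary hi
      refine ⟨disc k, V, disc.incl ε k, v, α ≫ τ', disc.isBd_incl ε k, hv, hα.core.comp hτ', ?_⟩
      rw [key, e₂, Category.assoc]

theorem hasGood_cellHom (X : Glob.{u}) (n : ℕ) (c : (Free X).Cells n) : HasGood (cellHom c) := by
  refine cell_induction (P := fun X n c => HasGood (cellHom c)) ?_ ?_ X n c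
  · intro X n x
    exact ⟨_, 𝟙 _, _, Good.id _, by rw [cellHom_var, Category.id_comp]⟩
  · intro X n B hB A hA τ ih hg
    obtain ⟨U, τ', f, hτ', rfl⟩ := (built B).hasGood τ ih
    exact ⟨_, _, f, good_coh hB A hA hτ' hg, by rw [cellHom_comp, act_coh]⟩

theorem hasGood {B : Bat} {X : Glob.{u}} (σ : Free (pos.{u} B) ⟶ Free X) : HasGood σ :=
  (built B).hasGood σ fun m _ => hasGood_cellHom X m _

-- Density of `Θ₀` and the arities of `fcw`

section Arities

/-- The inclusion of `Θ₀` in globular sets. -/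
abbrev arity : Theta₀.{u} ⥤ Glob.{u} := inducedFunctor pos.{u}

/-- An object of `Θ₀` over a globular set. -/
def overMk {X : Glob.{u}} (B : Theta₀.{u}) (f : arity.{u}.obj B ⟶ X) :
    CostructuredArrow arity.{u} X :=
  CostructuredArrow.mk (S := arity.{u}) (Y := B) f

/-- Morphisms of `Θ₀` over a globular set. -/
def overHom {X : Glob.{u}} {B B' : Theta₀.{u}} {f : arity.{u}.obj B ⟶ X}
    {f' : arity.{u}.obj B' ⟶ X} (h : arity.{u}.obj B ⟶ arity.{u}.obj B') (w : h ≫ f' = f) :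
    overMk B f ⟶ overMk B' f' :=
  CostructuredArrow.homMk (f := overMk B f) (f' := overMk B' f')
    (InducedCategory.homMk (X := B) (Y := B') h) w

/-- Disks are trees and represent cells: the induced map is read off the leg at the disk of each
cell, and the inclusions of boundary disks make it globular. -/
theorem isColimit_canonicalCocone (X : Glob.{u}) :
    Nonempty (IsColimit (canonicalCocone arity.{u} X)) := by
  have nat : ∀ (s : Cocone (CostructuredArrow.proj arity.{u} X ⋙ arity)) {B B' : Theta₀.{u}}
      {f : arity.{u}.obj B ⟶ X} {f' : arity.{u}.obj B' ⟶ X}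
      (h : arity.{u}.obj B ⟶ arity.{u}.obj B') (w : h ≫ f' = f),
      h ≫ s.ι.app (overMk B' f') = s.ι.app (overMk B f) := fun s _ _ _ _ h w => s.w (overHom h w)
  let leg : ∀ (s : Cocone (CostructuredArrow.proj arity.{u} X ⋙ arity)) (B : Bat)
    (f : pos.{u} B ⟶ X), pos.{u} B ⟶ s.pt := fun s B f => s.ι.app (overMk B f)
  have leg_eq : ∀ s {B B' : Bat} {f : pos.{u} B ⟶ X} {f' : pos.{u} B' ⟶ X}
      (h : pos.{u} B ⟶ pos.{u} B') (_ : h ≫ f' = f), h ≫ leg s B' f' = leg s B f :=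
    fun s _ _ _ _ h w => nat s h w
  let d : ∀ s : Cocone (CostructuredArrow.proj arity.{u} X ⋙ arity), X ⟶ s.pt := fun s =>
    Glob.homMk (fun n x => Glob.Hom.app (leg s (disc n) (disc.map n X x)) n (disc.top n))
      fun ε n x => by
        rw [← leg_eq s (disc.incl ε n) (disc.incl_comp x), Glob.comp_app, disc.incl, disc.map_top,
          Glob.app_face]
  refine ⟨{ desc := d, fac := fun s a => ?_, uniq := fun s m hm => ?_ }⟩
  · refine Glob.hom_ext fun n p => ?_
    have h := leg_eq s (f' := a.hom) (disc.map n _ p) (disc.map_comp p a.hom)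
    refine (congrArg (fun f : pos.{u} (disc n) ⟶ s.pt => Glob.Hom.app f n (disc.top n)) h).symm.trans
      ?_
    exact congrArg (Glob.Hom.app (leg s a.left a.hom) n) (disc.map_top n (pos.{u} a.left) p)
  · refine Glob.hom_ext fun n x => ?_
    refine Eq.trans ?_ (congrArg (fun f : pos.{u} (disc n) ⟶ s.pt => Glob.Hom.app f n (disc.top n))
      (hm (overMk (disc n) (disc.map n X x))))
    exact congrArg (Glob.Hom.app m n) (disc.map_top n X x).symm

theorem toGlob_comp_map {X Y Z : Glob.{u}} (σ : Free X ⟶ Free Y) (f : Y ⟶ Z) :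
    toGlob (σ ≫ freeComputad.map f) = toGlob σ ≫ cells.map (freeComputad.map f) := by
  rw [toGlob, toGlob, Functor.map_comp, Category.assoc]

theorem toGlob_lift {X : Glob.{u}} {C : Comp.{u}} (g : X ⟶ cells.obj C) : toGlob (lift g) = g :=
  Glob.hom_ext fun _ _ => by rw [toGlob_app, act_lift]

theorem isColimit_nerve (X : Glob.{u}) :
    Nonempty (IsColimit ((fcw.{u}.toFunctor ⋙ nerve arity.{u}).mapCocone
      (canonicalCocone arity.{u} X))) := by
  refine ⟨evaluationJointlyReflectsColimits _ fun k => ?_⟩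
  obtain ⟨B⟩ := k
  have hgood : ∀ ρ : pos.{u} B ⟶ cells.obj (Free X), ∃ (U : Bat) (σ : Free (pos.{u} B) ⟶ Free (pos.{u} U))
      (f : pos.{u} U ⟶ X), StrongGeneric σ ∧ toGlob σ ≫ cells.map (freeComputad.map f) = ρ := fun ρ => by
    obtain ⟨U, σ, f, hσ, h⟩ := hasGood (lift ρ)
    exact ⟨U, σ, f, hσ.core.generic, by rw [← toGlob_comp_map, h, toGlob_lift]⟩
  choose U σ f hσ hf using hgood
  refine
    -- Colimits of presheaves are pointwise; an element `ρ` at `B` is represented by the generic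
    -- part of its chosen factorisation.
    { desc := fun s => ↾ fun ρ => s.ι.app (overMk (U ρ) (f ρ)) (toGlob (σ ρ))
      fac := fun s a => ?_
      uniq := fun s m hm => ?_ }
  · ext ρ
    let ρ' : pos.{u} B ⟶ cells.obj (Free (pos.{u} a.left)) := ρ
    let ρ'' : pos.{u} B ⟶ cells.obj (Free X) := ρ' ≫ cells.map (freeComputad.map a.hom)
    have e : σ ρ'' ≫ freeComputad.map (f ρ'') = lift ρ' ≫ freeComputad.map a.hom := toGlob_injective (by
      rw [toGlob_comp_map, toGlob_comp_map, hf, toGlob_lift])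
    -- The generic representative maps to the given one by a morphism of `Θ₀` over `X`, so the value
    -- of the cocone does not depend on the representative.
    obtain ⟨k, hk, hk'⟩ := (hσ ρ'').generic.exists_map e
    have hw := ConcreteCategory.congr_hom (s.w (overHom (B := U ρ'') (B' := a.left) (f := f ρ'') (f' := a.hom) k hk'))
      (toGlob (σ ρ''))
    refine hw.symm.trans (congrArg (s.ι.app a) ?_)
    refine (toGlob_comp_map (σ ρ'') k).symm.trans ?_
    rw [hk, toGlob_lift]
  · ext ρ
    have h := ConcreteCategory.congr_hom (hm (overMk (U ρ) (f ρ))) (toGlob (σ ρ))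
    exact (congrArg m (hf ρ)).symm.trans h

end Arities

end Computads

theorem mainTheorem8 :
    (∀ (B : Bat) (X : Glob.{u}) (σ : freeComputad.obj (pos.{u} B) ⟶ freeComputad.obj X),
      ∃ F : (Σ B' : Bat, (freeComputad.obj (pos.{u} B) ⟶ freeComputad.obj (pos.{u} B')) ×
          (freeComputad.obj (pos.{u} B') ⟶ freeComputad.obj X)),
        IsGenericFreeFactorisation σ F ∧ F.1.dim ≤ B.dim ∧
          ∀ F', IsGenericFreeFactorisation σ F' → F' = F) ∧
    HasArities (inducedFunctor pos.{u} : Theta₀.{u} ⥤ Glob.{u}) fcw.{u} := by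
  refine ⟨fun B X σ => ?_, inferInstance, inferInstance, isColimit_canonicalCocone,
    isColimit_nerve⟩
  obtain ⟨U, σ', f, hσ', rfl⟩ := hasGood σ
  refine ⟨⟨U, σ', freeComputad.map f⟩, ⟨hσ'.core.generic.generic, genPres_iff.2 ⟨f, rfl⟩, rfl⟩,
    hσ'.core.dim_le, ?_⟩
  rintro ⟨U', τ, g⟩ ⟨hτ, hg, e⟩
  change Generic τ at hτ
  change Comp.GenPres g at hg
  change τ ≫ g = _ at e
  obtain ⟨g, rfl⟩ := genPres_iff.1 hg
  -- Once the right factors are globular maps, uniqueness is the rigidity of generic factorisations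
  -- through trees.
  obtain ⟨rfl, h⟩ := Sigma.mk.inj_iff.1
    (generic_factorisation_unique hτ hσ'.core.generic.generic e)
  obtain ⟨rfl, rfl⟩ := Prod.mk.inj (eq_of_heq h)
  rfl
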